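/- **Setting.** Fix two datasets $D_1,D_2$. A mechanism $M$ with output space $\mathcal Y$ is viewed through the testing pair $(P,Q)=(M(D_1),M(D_2))$ of probability measures on $\mathcal Y$. The privacy loss distribution $\operatorname{PLD}(P\parallel Q)$ is the law on $\mathbb R\cup\{\infty\}$ of $\log\frac{dP}{dQ}(\omega)$, $\omega\sim P$, where $\frac{dP}{dQ}:=\frac{dP}{d\nu}\big/\frac{dQ}{d\nu}$ with $\nu=P+Q$ (and $\cdot/0:=\infty$). A *PLD* is a distribution that arises in this way. A pair $(P',Q')$ on $\Omega'$ dominates a pair $(P,Q)$ on $\Omega$ in the Blackwell order, $(P,Q)\preceq(P',Q')$, if there is a Markov kernel $\phi$ from $\Omega'$ to $\Omega$ with $P=\phi P'$ and $Q=\phi Q'$; for PLDs, $L\preceq L'$ means that there are pairs $(P,Q)\preceq(P',Q')$ with $L=\operatorname{PLD}(P\parallel Q)$ and $L'=\operatorname{PLD}(P'\parallel Q')$. Write $\oplus$ for convolution of PLDs and $\mathrm{Id}$ for the point mass at $0$. For a family $\mathcal L$ of PLDs let $\mathcal L^\infty=\{L_1\oplus\dots\oplus L_n: n\ge 0,\ L_1,\dots,L_n\in\mathcal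 L\}$ be its closure under composition (the empty convolution is $\mathrm{Id}$). **Natural filter.** Let $B$ be a PLD (the budget) and $k\ge1$ (the query capacity). An adversary against the natural filter with budget $B$, queries in $\mathcal L$ and capacity $k$ is an adaptive composition $M=M_1\otimes\dots\otimes M_k$, where $M_i$ is a mechanism that may depend (measurably) on the earlier outputs $y_1,\dots,y_{i-1}$, such that, for every $i\le k$ and all outputs $y_1,y_2,\dots$, the PLDs $L_j:=\operatorname{PLD}(M_j(\cdot\,;y_1,\dots,y_{j-1}))$ satisfy $$L_i\in\mathcal L\cup\{\mathrm{Id}\}\quad\text{and}\quad L_1\oplus\dots\oplus L_i\preceq B .$$ The natural filter is *free* for $B$ and $k$ if every such adversary satisfies $\operatorname{PLD}(M)\preceq B$. **Theorem.** Let $\mathcal L$ be a family of non-degenerate PLDs, i.e. the support of every $L\in\mathcal L$ contains at least two points of $\mathbb R$. The natural filter with queries in $\mathcal L$ is free for every budget $B$ and every query capacity $k\ge1$ if and only if $\mathcal L^\infty$ is totally ordered by $\preceq$, i.e. for all $L_1,L_2\in\mathcal L^\infty$ one has $L_1\preceq L_2$ or $L_2\preceq L_1$. -/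

import Mathlib

open MeasureTheory ProbabilityTheory

universe u

namespace PrivacyFilter

/-- The privacy loss distribution of the testing pair `(P, Q)`: the law, under `P`, of the logarithm
of the likelihood ratio `dP/dQ`. The ratio is formed from the densities with respect to `P + Q`, so
that no absolute continuity is needed. It is a distribution on `ℝ ∪ {∞}`, regarded as a measure
on `EReal` (the likelihood ratio vanishes only on a `P`-null set, so `⊥` gets no mass). -/
noncomputable def pld {Ω : Type u} [MeasurableSpace Ω] (P Q : Measure Ω) : Measure EReal :=
  P.map fun ω => ENNReal.log (P.rnDeriv (P + Q) ω / Q.rnDeriv (P + Q) ω)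

/-- A distribution is a PLD if it is the privacy loss distribution of some testing pair. -/
def IsPLD (L : Measure EReal) : Prop :=
  ∃ (Ω : Type) (_ : MeasurableSpace Ω) (P Q : Measure Ω),
    IsProbabilityMeasure P ∧ IsProbabilityMeasure Q ∧ pld P Q = L

/-- Blackwell order on testing pairs: `(P', Q')` dominates `(P, Q)` if one Markov kernel maps `P'`
to `P` and `Q'` to `Q`. -/
def BlackwellLE {Ω Ω' : Type*} [MeasurableSpace Ω] [MeasurableSpace Ω']
    (P Q : Measure Ω) (P' Q' : Measure Ω') : Prop :=
  ∃ φ : Kernel Ω' Ω, IsMarkovKernel φ ∧ P = P'.bind φ ∧ Q = Q'.bind φ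

/-- Blackwell order on PLDs: `L ⪯ L'` if there are testing pairs with PLDs `L` and `L'` that are so
ordered. -/
def PLDLE (L L' : Measure EReal) : Prop :=
  ∃ (Ω Ω' : Type) (_ : MeasurableSpace Ω) (_ : MeasurableSpace Ω')
    (P Q : Measure Ω) (P' Q' : Measure Ω'),
    IsProbabilityMeasure P ∧ IsProbabilityMeasure Q ∧
    IsProbabilityMeasure P' ∧ IsProbabilityMeasure Q' ∧
    pld P Q = L ∧ pld P' Q' = L' ∧ BlackwellLE P Q P' Q'

/-- The PLD `Id` of a mechanism that reveals nothing: the point mass at zero. -/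
noncomputable def idPLD : Measure EReal := Measure.dirac 0

/-- The convolution `L₁ ⊕ ⋯ ⊕ Lₙ` of a list of distributions (`Id` for the empty list). -/
noncomputable def compose (l : List (Measure EReal)) : Measure EReal :=
  l.foldl Measure.conv idPLD

/-- The composition closure `𝓛^∞`: all finite convolutions of members of `𝓛`. -/
def compositionClosure (𝓛 : Set (Measure EReal)) : Set (Measure EReal) :=
  {L | ∃ l : List (Measure EReal), (∀ K ∈ l, K ∈ 𝓛) ∧ compose l = L}

/-- The support of `L` contains at least two real points. -/
def NonDegenerate (L : Measure EReal) : Prop :=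
  ∃ s t : ℝ, s ≠ t ∧ (s : EReal) ∈ L.support ∧ (t : EReal) ∈ L.support

/-- Transcripts `(Y₁, …, Yₙ)` of the first `n` rounds of an interaction. -/
def History (Y : ℕ → Type u) : ℕ → Type u
  | 0 => PUnit
  | n + 1 => History Y n × Y n

instance History.instMeasurableSpace (Y : ℕ → Type u) [∀ i, MeasurableSpace (Y i)] :
    ∀ n, MeasurableSpace (History Y n)
  | 0 => (inferInstance : MeasurableSpace PUnit)
  | n + 1 =>
    letI := History.instMeasurableSpace Y n
    (inferInstance : MeasurableSpace (History Y n × Y n))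

/-- A sequence of adaptively chosen mechanisms. The two datasets being fixed, a mechanism is
recorded through its two output distributions. Round `i` (counted from zero) has outputs in `Y i`;
given the transcript `h` of the earlier rounds, its output has law `kerP i h` on the first dataset
and `kerQ i h` on the second. An interaction of `k` rounds uses only the rounds `i < k`. -/
structure AdaptiveMechanism where
  Y : ℕ → Type u
  [measY : ∀ i, MeasurableSpace (Y i)]
  kerP : ∀ i, Kernel (History Y i) (Y i)
  kerQ : ∀ i, Kernel (History Y i) (Y i)
  [markovP : ∀ i, IsMarkovKernel (kerP i)]
  [markovQ : ∀ i, IsMarkovKernel (kerQ i)]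

attribute [instance] AdaptiveMechanism.measY AdaptiveMechanism.markovP AdaptiveMechanism.markovQ

/-- The law of the transcript of the first `n` rounds when round `i` uses the kernel `κ i`: the
adaptive composition of these rounds. -/
noncomputable def transcriptLaw {Y : ℕ → Type u} [∀ i, MeasurableSpace (Y i)]
    (κ : ∀ i, Kernel (History Y i) (Y i)) : ∀ n, Measure (History Y n)
  | 0 => (Measure.dirac PUnit.unit : Measure PUnit)
  | n + 1 => ((transcriptLaw κ n).compProd (κ n) : Measure (History Y n × Y n))

namespace AdaptiveMechanism

/-- The PLD of the mechanism run in round `i` after the transcript `h`. -/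
noncomputable def roundPLD (M : AdaptiveMechanism.{u}) (i : ℕ) (h : History M.Y i) :
    Measure EReal :=
  pld (M.kerP i h) (M.kerQ i h)

/-- The list `(L₁, …, Lₙ)` of the PLDs of the mechanisms run along the transcript `h`. -/
noncomputable def pastPLDs (M : AdaptiveMechanism.{u}) :
    ∀ n, History M.Y n → List (Measure EReal)
  | 0, _ => []
  | n + 1, h => M.pastPLDs n h.1 ++ [M.roundPLD n h.1]

/-- The PLD of the adaptive composition of the first `k` rounds, that is, of the mechanism
that outputs the whole transcript. -/
noncomputable def totalPLD (M : AdaptiveMechanism.{u}) (k : ℕ) : Measure EReal :=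
  pld (transcriptLaw M.kerP k) (transcriptLaw M.kerQ k)

/-- A privacy rule `Γ` maps the list of PLDs played so far to the set of PLDs that may be played
next. A `Γ`-adversary of length `k` respects the rule in each of its `k` rounds, whatever the
transcript. -/
def IsAdversary (Γ : List (Measure EReal) → Set (Measure EReal)) (k : ℕ)
    (M : AdaptiveMechanism.{u}) : Prop :=
  ∀ i < k, ∀ h : History M.Y i, M.roundPLD i h ∈ Γ (M.pastPLDs i h)

end AdaptiveMechanism

/-- The rule of the natural filter with budget `B` and queries in `𝓛`: after `L₁, …, Lᵢ`, a query
with PLD `L ∈ 𝓛`, or the trivial query `Id`, is answered if `L₁ ⊕ ⋯ ⊕ Lᵢ ⊕ L ⪯ B`. -/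
def filterRule (𝓛 : Set (Measure EReal)) (B : Measure EReal)
    (l : List (Measure EReal)) : Set (Measure EReal) :=
  {L | L ∈ insert idPLD 𝓛 ∧ PLDLE (compose (l ++ [L])) B}

/-- The natural filter with budget `B`, queries in `𝓛` and capacity `k` is free: every interaction
with it has a PLD dominated by `B`. -/
def FreeNaturalFilter (𝓛 : Set (Measure EReal)) (B : Measure EReal) (k : ℕ) : Prop :=
  ∀ M : AdaptiveMechanism.{u}, M.IsAdversary (filterRule 𝓛 B) k → PLDLE (M.totalPLD k) B

end PrivacyFilter

/-! The order is handled through hockey-stick profiles: by Blackwell's theorem (`pldLE_iff`), `L ⪯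
L'` holds exactly when the profile of `L` lies below that of `L'` at every finite slope `γ`.
Necessity is data processing for the Neyman-Pearson test. For sufficiency, the profiles determine
the order on kink functions of the posterior, hence on all convex functions of it, hence on the
values of all decision problems, and Hahn-Banach with Riesz representation then produces the
garbling kernel. Convolution acts simply: the profile of `K ⊕ L` at `γ` is the mean over `l ∼ K` of
the profile of `L` at `γ e^{-l}` (`hockeyStick_conv`).

Suppose that the closure is a chain. Backward induction over the rounds bounds the advantage of any
test on the transcript (`lintegral_transcriptLaw_le`). Since the adversary may continue differently
after each output, one round yields the expectation of a supremum of profiles; for a chain this is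
at most the supremum of the expectations (`lintegral_iSup_hockeyStick`). Adaptivity therefore gains
nothing over the best fixed sequence of queries, and each such sequence has passed the filter.

Suppose that the filter is free, and let `D` be the difference of the profiles of `L₁` and `L₂`. If
`s`, `t` are losses in the support of some `K` in the closure and `D` has strictly opposite signs at
`γ e^{-s}` and `γ e^{-t}`, then playing `K` and afterwards the better of `L₁`, `L₂` strictly beats
both fixed sequences at `γ`. The largest budget that both sequences respect at `γ` is then exceeded
(`not_crossing_of_free`). So `D` has no strict sign change between points whose logarithms differ by
an element of the group of loss differences. If this group is dense, continuity of `D` gives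
comparability. Otherwise it is cyclic, nontrivial by non-degeneracy, and all laws live on translates
of one lattice. The profiles are then piecewise affine, and a sign change would force the values of
`D` at the kinks to form a geometric progression, which the bounds `|D| ≤ 1` and `|D x| ≤ x` exclude
(`false_of_sign_constant`). -/

namespace PrivacyFilter

open scoped ENNReal

/-! ### Likelihood ratios, hockey-stick profiles and optimal tests -/

/-- The likelihood ratio `dQ/dP` as a function of the privacy loss `log (dP/dQ)`. -/
noncomputable def lossRatio (l : EReal) : ℝ≥0∞ := (EReal.exp l)⁻¹

/-- The hockey-stick profile `γ ↦ ∫ (1 - γ e^{-l})⁺ dL(l)` of a distribution of privacy losses. -/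
noncomputable def hockeyStick (L : Measure EReal) (γ : ℝ≥0∞) : ℝ≥0∞ :=
  ∫⁻ l, (1 - γ * lossRatio l) ∂L

lemma measurable_lossRatio : Measurable lossRatio := EReal.measurable_exp.inv

lemma continuous_lossRatio : Continuous lossRatio :=
  continuous_inv.comp ENNReal.continuous_exp

lemma lossRatio_log_inv (x : ℝ≥0∞) : lossRatio (ENNReal.log x⁻¹) = x := by
  simp [lossRatio]

lemma log_inv_lossRatio (l : EReal) : ENNReal.log (lossRatio l)⁻¹ = l := by
  simp [lossRatio]

@[simp] lemma lossRatio_top : lossRatio ⊤ = 0 := by simp [lossRatio]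

@[simp] lemma lossRatio_bot : lossRatio ⊥ = ∞ := by simp [lossRatio]

@[simp] lemma lossRatio_zero : lossRatio 0 = 1 := by simp [lossRatio]

lemma lossRatio_eq_top {l : EReal} : lossRatio l = ∞ ↔ l = ⊥ := by simp [lossRatio]

lemma lossRatio_coe (x : ℝ) : lossRatio x = ENNReal.ofReal (Real.exp (-x)) := by
  rw [lossRatio, EReal.exp_coe, Real.exp_neg, ENNReal.ofReal_inv_of_pos (Real.exp_pos x)]

lemma lossRatio_add {x y : EReal} (hx : x ≠ ⊥) (hy : y ≠ ⊥) :
    lossRatio (x + y) = lossRatio x * lossRatio y := by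
  simp only [lossRatio, EReal.exp_add]
  rw [ENNReal.mul_inv] <;> simp [hx, hy]

section Pair

variable {Ω : Type*} [MeasurableSpace Ω] (P Q : Measure Ω)

/-- `P`-almost everywhere the density of `P` with respect to `P + Q` is positive and finite, so the
quotient may be inverted and the reference measure `P + Q` drops out. -/
lemma pld_eq {Ω : Type u} [MeasurableSpace Ω] (P Q : Measure Ω) [IsFiniteMeasure P]
    [IsFiniteMeasure Q] : pld P Q = P.map fun ω => ENNReal.log (Q.rnDeriv P ω)⁻¹ := by
  have hP : P ≪ P + Q := Measure.AbsolutelyContinuous.rfl.add_right Q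
  have hQ : Q ≪ P + Q := by
    rw [add_comm]; exact Measure.AbsolutelyContinuous.rfl.add_right P
  refine Measure.map_congr ?_
  filter_upwards [Measure.rnDeriv_eq_div hQ hP, Measure.rnDeriv_pos hP,
    hP.ae_le (Measure.rnDeriv_lt_top P (P + Q))] with ω h h0 ht
  rw [h, ENNReal.inv_div (Or.inl ht.ne) (Or.inl h0.ne')]

lemma measurable_log_inv_rnDeriv : Measurable fun ω => ENNReal.log (Q.rnDeriv P ω)⁻¹ :=
  (Measure.measurable_rnDeriv Q P).inv.ennreal_log

end Pair

/-- The bound for a test of power `x` when nothing more is revealed. It yields weak duality for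
tests and also starts the backward induction over transcripts. -/
lemma le_mul_add_one_sub {x : ℝ≥0∞} (hx : x ≤ 1) (γ : ℝ≥0∞) : x ≤ γ * x + (1 - γ) := by
  rcases le_total γ 1 with h | h
  · calc x = γ * x + (1 - γ) * x := by rw [← add_mul, add_tsub_cancel_of_le h, one_mul]
      _ ≤ γ * x + (1 - γ) := by
          gcongr
          exact mul_le_of_le_one_right' hx
  · exact (le_mul_of_one_le_left' h).trans le_self_add

section TypeU

variable {Ω : Type u} [MeasurableSpace Ω] (P Q : Measure Ω) [IsProbabilityMeasure P]
  [IsProbabilityMeasure Q]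

lemma lintegral_pld {S : ℝ≥0∞ → ℝ≥0∞} (hS : Measurable S) :
    ∫⁻ l, S (lossRatio l) ∂(pld P Q) = ∫⁻ ω, S (Q.rnDeriv P ω) ∂P := by
  rw [pld_eq, lintegral_map (f := fun l => S (lossRatio l)) (hS.comp measurable_lossRatio)
    (measurable_log_inv_rnDeriv P Q)]
  simp only [lossRatio_log_inv]

/-- A probability measure on `EReal` that satisfies the conditions which characterise privacy loss
distributions. -/
structure IsLossLaw (L : Measure EReal) : Prop where
  prob : IsProbabilityMeasure L
  bot : L {⊥} = 0
  ratio : ∫⁻ l, lossRatio l ∂L ≤ 1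

lemma isLossLaw_pld : IsLossLaw (pld P Q) where
  prob := by
    rw [pld_eq]
    exact Measure.isProbabilityMeasure_map (measurable_log_inv_rnDeriv P Q).aemeasurable
  bot := by
    rw [pld_eq, Measure.map_apply (measurable_log_inv_rnDeriv P Q) (measurableSet_singleton _)]
    refine measure_mono_null ?_ (ae_iff.1 (Measure.rnDeriv_lt_top Q P))
    intro ω hω
    have : ENNReal.log (Q.rnDeriv P ω)⁻¹ = ⊥ := hω
    simpa using this
  ratio := by
    have := lintegral_pld P Q measurable_id
    simp only [id] at this
    rw [this]
    exact Measure.lintegral_rnDeriv_le.trans_eq measure_univ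

/-- Bayes risk bound for a two-stage test: `u` and `v` are the acceptance probabilities of the
second stage under the two hypotheses. -/
lemma lintegral_le_of_pointwise {u v : Ω → ℝ≥0∞} (hv : Measurable v)
    {S : ℝ≥0∞ → ℝ≥0∞} (hS : Measurable S)
    (h : ∀ ω, ∀ γ : ℝ≥0∞, γ ≠ ∞ → u ω ≤ γ * v ω + S γ) {γ : ℝ≥0∞} (hγ : γ ≠ ∞) :
    ∫⁻ ω, u ω ∂P ≤ γ * ∫⁻ ω, v ω ∂Q + ∫⁻ l, S (γ * lossRatio l) ∂(pld P Q) := by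
  rw [lintegral_pld P Q (S := fun x => S (γ * x)) (hS.comp (measurable_const_mul γ))]
  have hr := Measure.measurable_rnDeriv Q P
  calc ∫⁻ ω, u ω ∂P
      ≤ ∫⁻ ω, (γ * (Q.rnDeriv P ω * v ω) + S (γ * Q.rnDeriv P ω)) ∂P := by
        refine lintegral_mono_ae ?_
        filter_upwards [Measure.rnDeriv_lt_top Q P] with ω hω
        rw [← mul_assoc]
        -- Observing `ω` updates the slope from `γ` to `γ · dQ/dP(ω)`, as Bayes' rule updates prior
        -- odds.
        exact h ω _ (ENNReal.mul_ne_top hγ hω.ne)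
    _ = γ * ∫⁻ ω, (Q.rnDeriv P ω * v ω) ∂P + ∫⁻ ω, S (γ * Q.rnDeriv P ω) ∂P := by
        rw [lintegral_add_left (by fun_prop), lintegral_const_mul _ (by fun_prop)]
    _ ≤ _ := by
        -- The part of `Q` singular to `P` only enlarges the right-hand side.
        refine add_le_add_left (mul_le_mul_right ?_ γ) _
        calc ∫⁻ ω, (Q.rnDeriv P ω * v ω) ∂P = ∫⁻ ω, v ω ∂(P.withDensity (Q.rnDeriv P)) :=
              (lintegral_withDensity_eq_lintegral_mul P hr hv).symm
          _ ≤ ∫⁻ ω, v ω ∂Q := lintegral_mono' (Measure.withDensity_rnDeriv_le Q P) le_rfl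

lemma lintegral_le_hockeyStick {f : Ω → ℝ≥0∞} (hf : Measurable f) (h1 : ∀ ω, f ω ≤ 1)
    {γ : ℝ≥0∞} (hγ : γ ≠ ∞) :
    ∫⁻ ω, f ω ∂P ≤ γ * ∫⁻ ω, f ω ∂Q + hockeyStick (pld P Q) γ := by
  refine lintegral_le_of_pointwise P Q hf (S := fun x => 1 - x) (by fun_prop) ?_ hγ
  exact fun ω γ _ => le_mul_add_one_sub (h1 ω) γ

/-- Neyman-Pearson: the optimal test accepts where `γ · dQ/dP ≤ 1`. Intersecting with `E`, which has
full `P`-measure, removes the singular part of `Q` at no cost. -/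
lemma exists_test_eq_hockeyStick (γ : ℝ≥0∞) :
    ∃ f : Ω → ℝ≥0∞, Measurable f ∧ (∀ ω, f ω ≤ 1) ∧
      ∫⁻ ω, f ω ∂P = γ * ∫⁻ ω, f ω ∂Q + hockeyStick (pld P Q) γ := by
  have hr := Measure.measurable_rnDeriv Q P
  obtain ⟨E, hE, hE1, hE2⟩ := Measure.mutuallySingular_singularPart Q P
  set A := {ω | γ * Q.rnDeriv P ω ≤ 1} with hA
  have hAm : MeasurableSet A := measurableSet_le (hr.const_mul γ) measurable_const
  refine ⟨(A ∩ E).indicator 1, measurable_one.indicator (hAm.inter hE), fun ω => ?_, ?_⟩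
  · exact Set.indicator_le_self' (by simp) ω
  have hE2' : P Eᶜ = 0 := hE2
  have hQ : Q (A ∩ E) = ∫⁻ ω in A, Q.rnDeriv P ω ∂P := by
    conv_lhs => rw [← Measure.singularPart_add_rnDeriv Q P]
    rw [Measure.add_apply, measure_mono_null Set.inter_subset_right hE1, zero_add,
      withDensity_apply _ (hAm.inter hE)]
    refine setLIntegral_congr ?_
    exact inter_ae_eq_left_of_ae_eq_univ (by rwa [ae_eq_univ])
  have hP : P (A ∩ E) = P A :=
    measure_congr (inter_ae_eq_left_of_ae_eq_univ (by rwa [ae_eq_univ]))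
  have hH : hockeyStick (pld P Q) γ = ∫⁻ ω in A, (1 - γ * Q.rnDeriv P ω) ∂P := by
    rw [hockeyStick, lintegral_pld P Q (S := fun x => 1 - γ * x) (by fun_prop),
      ← lintegral_add_compl _ hAm]
    have : ∫⁻ ω in Aᶜ, (1 - γ * Q.rnDeriv P ω) ∂P = 0 := by
      rw [setLIntegral_congr_fun hAm.compl (g := fun _ => 0), lintegral_zero]
      intro ω hω
      exact tsub_eq_zero_of_le (not_le.1 (show ¬ γ * Q.rnDeriv P ω ≤ 1 from hω)).le
    rw [this, add_zero]
  rw [lintegral_indicator_one (hAm.inter hE), lintegral_indicator_one (hAm.inter hE), hQ, hP, hH,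
    ← lintegral_const_mul _ hr, ← lintegral_add_left (hr.const_mul γ)]
  rw [setLIntegral_congr_fun hAm (g := fun _ => 1)]
  · simp
  · intro ω hω
    exact add_tsub_cancel_of_le hω

end TypeU

/-! ### Canonical testing pairs and the characterisation of PLDs -/

/-- The second member of the canonical testing pair on `EReal` whose first member is `L`. -/
noncomputable def dualLaw (L : Measure EReal) : Measure EReal :=
  L.withDensity lossRatio + (1 - ∫⁻ l, lossRatio l ∂L) • Measure.dirac ⊥

lemma lintegral_dualLaw (L : Measure EReal) {f : EReal → ℝ≥0∞} (hf : Measurable f) (h0 : f ⊥ = 0) :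
    ∫⁻ l, f l ∂(dualLaw L) = ∫⁻ l, f l * lossRatio l ∂L := by
  rw [dualLaw, lintegral_add_measure, lintegral_smul_measure, lintegral_dirac, h0, smul_zero,
    add_zero, lintegral_withDensity_eq_lintegral_mul _ measurable_lossRatio hf]
  simp [mul_comm]

namespace IsLossLaw

variable {L L' : Measure EReal}

lemma isProbabilityMeasure_dualLaw (hL : IsLossLaw L) : IsProbabilityMeasure (dualLaw L) := by
  constructor
  simp [dualLaw, add_tsub_cancel_of_le hL.ratio]

lemma ae_ne_bot (hL : IsLossLaw L) : ∀ᵐ l ∂L, l ≠ ⊥ := by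
  simpa [ae_iff] using hL.bot

/-- The atom at `⊥` carries the mass missing from the density part, and it is singular to `L`
because `L` does not charge `⊥`. -/
lemma rnDeriv_dualLaw (hL : IsLossLaw L) : (dualLaw L).rnDeriv L =ᵐ[L] lossRatio := by
  have := hL.prob
  refine (Measure.eq_rnDeriv (s := (1 - ∫⁻ l, lossRatio l ∂L) • Measure.dirac ⊥)
    measurable_lossRatio ?_ ?_).symm
  · refine Measure.MutuallySingular.smul _ ⟨{⊥}ᶜ, (measurableSet_singleton _).compl, ?_, ?_⟩
    · simp
    · simpa using hL.bot
  · rw [dualLaw, add_comm]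

lemma pld_dualLaw (hL : IsLossLaw L) : pld L (dualLaw L) = L := by
  have := hL.prob
  have := hL.isProbabilityMeasure_dualLaw
  rw [pld_eq]
  conv_rhs => rw [← Measure.map_id (μ := L)]
  refine Measure.map_congr ?_
  filter_upwards [hL.rnDeriv_dualLaw] with l hl
  rw [hl, log_inv_lossRatio, id]

lemma isPLD (hL : IsLossLaw L) : IsPLD L :=
  ⟨EReal, inferInstance, L, dualLaw L, hL.prob, hL.isProbabilityMeasure_dualLaw, hL.pld_dualLaw⟩

end IsLossLaw

lemma isPLD_iff {L : Measure EReal} : IsPLD L ↔ IsLossLaw L := by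
  refine ⟨?_, IsLossLaw.isPLD⟩
  rintro ⟨Ω, _, P, Q, _, _, rfl⟩
  exact isLossLaw_pld P Q

/-- Allows the canonical pair on `EReal` to be copied to a space in any universe. -/
lemma pld_map {Ω Ω' : Type*} [MeasurableSpace Ω] [MeasurableSpace Ω'] (P Q : Measure Ω)
    [IsProbabilityMeasure P] [IsProbabilityMeasure Q] (e : Ω ≃ᵐ Ω') :
    pld (P.map e) (Q.map e) = pld P Q := by
  have := Measure.isProbabilityMeasure_map (μ := P) e.measurable.aemeasurable
  have := Measure.isProbabilityMeasure_map (μ := Q) e.measurable.aemeasurable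
  rw [pld_eq, pld_eq, Measure.map_map (measurable_log_inv_rnDeriv _ _) e.measurable]
  refine Measure.map_congr ?_
  filter_upwards [e.measurableEmbedding.rnDeriv_map Q P] with ω hω
  simp only [Function.comp_apply, hω]

/-- Data processing: the optimal test for the dominated pair, averaged over the kernel, is a test
for the dominating pair with the same two acceptance probabilities. -/
lemma hockeyStick_le_of_pldLE {L L' : Measure EReal} (h : PLDLE L L') {γ : ℝ≥0∞} (hγ : γ ≠ ∞) :
    hockeyStick L γ ≤ hockeyStick L' γ := by
  obtain ⟨Ω, Ω', _, _, P, Q, P', Q', _, _, _, _, rfl, rfl, φ, _, hP, hQ⟩ := h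
  obtain ⟨f, hf, hf1, heq⟩ := exists_test_eq_hockeyStick P Q γ
  have key := lintegral_le_hockeyStick P' Q' (f := fun x => ∫⁻ y, f y ∂(φ x))
    hf.lintegral_kernel (fun x => (lintegral_mono hf1).trans (by simp)) hγ
  rw [← Measure.lintegral_bind φ.measurable.aemeasurable hf.aemeasurable,
    ← Measure.lintegral_bind φ.measurable.aemeasurable hf.aemeasurable, ← hP, ← hQ, heq] at key
  refine (ENNReal.add_le_add_iff_left (ENNReal.mul_ne_top hγ ?_)).1 key
  exact ((lintegral_mono hf1).trans_lt (by simp)).ne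

lemma antitone_hockeyStick (L : Measure EReal) : Antitone (hockeyStick L) := by
  intro a b hab
  exact lintegral_mono fun l => by gcongr

lemma measurable_hockeyStick (L : Measure EReal) : Measurable (hockeyStick L) :=
  (antitone_hockeyStick L).measurable

namespace IsLossLaw

variable {L L' : Measure EReal}

lemma hockeyStick_le_one (hL : IsLossLaw L) (γ : ℝ≥0∞) : hockeyStick L γ ≤ 1 := by
  have := hL.prob
  calc hockeyStick L γ ≤ ∫⁻ _, 1 ∂L := lintegral_mono fun l => tsub_le_self
    _ = 1 := by simp

lemma hockeyStick_ne_top (hL : IsLossLaw L) (γ : ℝ≥0∞) : hockeyStick L γ ≠ ∞ :=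
  ((hL.hockeyStick_le_one γ).trans_lt ENNReal.one_lt_top).ne

/-- A hockey-stick profile has slope at least `-1`. -/
lemma hockeyStick_le_add (hL : IsLossLaw L) (γ γ' : ℝ≥0∞) :
    hockeyStick L γ ≤ hockeyStick L γ' + (γ' - γ) := by
  have hm := measurable_lossRatio
  calc hockeyStick L γ
      ≤ ∫⁻ l, ((1 - γ' * lossRatio l) + (γ' - γ) * lossRatio l) ∂L := by
        refine lintegral_mono fun l => tsub_le_iff_right.2 ?_
        calc 1 ≤ 1 - γ' * lossRatio l + γ' * lossRatio l := le_tsub_add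
          _ ≤ 1 - γ' * lossRatio l + ((γ' - γ) + γ) * lossRatio l := by
            gcongr; exact le_tsub_add
          _ = _ := by ring
    _ = hockeyStick L γ' + (γ' - γ) * ∫⁻ l, lossRatio l ∂L := by
        rw [lintegral_add_left (by fun_prop), lintegral_const_mul _ hm]; rfl
    _ ≤ _ := by gcongr; exact mul_le_of_le_one_right' hL.ratio

/-- The right side dominates the profile of `Id`, so this makes `Id` the least PLD. It follows from
the value `1` at slope `0` and the slope bound. -/
lemma one_sub_le_hockeyStick (hL : IsLossLaw L) (γ : ℝ≥0∞) : 1 - γ ≤ hockeyStick L γ := by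
  have := hL.prob
  have h := hL.hockeyStick_le_add 0 γ
  rw [tsub_le_iff_right]
  simpa [hockeyStick] using h

lemma hockeyStick_zero (hL : IsLossLaw L) : hockeyStick L 0 = 1 := by
  have := hL.prob
  simp [hockeyStick]

/-- The profile of a convolution averages the profile of
the second factor over the privacy loss of the first. -/
lemma hockeyStick_conv (hL : IsLossLaw L) (hL' : IsLossLaw L') (γ : ℝ≥0∞) :
    hockeyStick (L.conv L') γ = ∫⁻ l, hockeyStick L' (γ * lossRatio l) ∂L := by
  have := hL.prob
  have := hL'.prob
  have hm := measurable_lossRatio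
  rw [hockeyStick, Measure.lintegral_conv (by fun_prop)]
  refine lintegral_congr_ae ?_
  filter_upwards [hL.ae_ne_bot] with x hx
  refine lintegral_congr_ae ?_
  filter_upwards [hL'.ae_ne_bot] with y hy
  rw [lossRatio_add hx hy, mul_assoc]

lemma conv (hL : IsLossLaw L) (hL' : IsLossLaw L') : IsLossLaw (L.conv L') where
  prob := by
    have := hL.prob
    have := hL'.prob
    infer_instance
  bot := by
    have := hL.prob
    have := hL'.prob
    rw [← lintegral_indicator_one (measurableSet_singleton _),
      Measure.lintegral_conv (measurable_one.indicator (measurableSet_singleton _))]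
    refine (lintegral_congr_ae ?_).trans lintegral_zero
    filter_upwards [hL.ae_ne_bot] with x hx
    refine (lintegral_congr_ae ?_).trans lintegral_zero
    filter_upwards [hL'.ae_ne_bot] with y hy
    simp [hx, hy]
  ratio := by
    have := hL.prob
    have := hL'.prob
    rw [Measure.lintegral_conv measurable_lossRatio]
    calc ∫⁻ x, ∫⁻ y, lossRatio (x + y) ∂L' ∂L
        = ∫⁻ x, lossRatio x * ∫⁻ y, lossRatio y ∂L' ∂L := by
          refine lintegral_congr_ae ?_
          filter_upwards [hL.ae_ne_bot] with x hx
          rw [← lintegral_const_mul _ measurable_lossRatio]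
          refine lintegral_congr_ae ?_
          filter_upwards [hL'.ae_ne_bot] with y hy
          rw [lossRatio_add hx hy]
      _ ≤ 1 := by
          rw [lintegral_mul_const _ measurable_lossRatio]
          exact mul_le_one' hL.ratio hL'.ratio

lemma hockeyStick_le_conv (hL : IsLossLaw L) (hL' : IsLossLaw L') (γ : ℝ≥0∞) :
    hockeyStick L γ ≤ hockeyStick (L.conv L') γ := by
  rw [hL.hockeyStick_conv hL']
  exact lintegral_mono fun l => hL'.one_sub_le_hockeyStick _

end IsLossLaw

/-! ### Finite compositions, and suprema over chains of profiles -/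

lemma isLossLaw_idPLD : IsLossLaw idPLD where
  prob := by rw [idPLD]; infer_instance
  bot := by simp [idPLD]
  ratio := by simp [idPLD]

lemma hockeyStick_idPLD (γ : ℝ≥0∞) : hockeyStick idPLD γ = 1 - γ := by
  simp [hockeyStick, idPLD]

@[simp] lemma compose_nil : compose [] = idPLD := rfl

lemma compose_concat (l : List (Measure EReal)) (L : Measure EReal) :
    compose (l ++ [L]) = (compose l).conv L := by
  simp [compose]

lemma isLossLaw_compose {l : List (Measure EReal)} (hl : ∀ L ∈ l, IsLossLaw L) :
    IsLossLaw (compose l) := by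
  induction l using List.reverseRecOn with
  | nil => exact isLossLaw_idPLD
  | append_singleton l L ih =>
    rw [compose_concat]
    exact (ih fun K hK => hl K (by simp [hK])).conv (hl L (by simp))

lemma conv_idPLD {L : Measure EReal} [SFinite L] : L.conv idPLD = L := by
  rw [idPLD, Measure.conv_dirac_zero]

lemma idPLD_conv {L : Measure EReal} [SFinite L] : idPLD.conv L = L := by
  rw [idPLD, Measure.dirac_zero_conv]

lemma compose_append {l l' : List (Measure EReal)} (hl : ∀ L ∈ l, IsLossLaw L)
    (hl' : ∀ L ∈ l', IsLossLaw L) : compose (l ++ l') = (compose l).conv (compose l') := by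
  have := (isLossLaw_compose hl).prob
  induction l' using List.reverseRecOn with
  | nil => simp [conv_idPLD]
  | append_singleton l' L ih =>
    have h1 : ∀ K ∈ l', IsLossLaw K := fun K hK => hl' K (by simp [hK])
    have := (isLossLaw_compose h1).prob
    have := (hl' L (by simp)).prob
    rw [← List.append_assoc, compose_concat, ih h1, compose_concat, Measure.conv_assoc]

lemma compose_cons {L : Measure EReal} {l : List (Measure EReal)} (hL : IsLossLaw L)
    (hl : ∀ K ∈ l, IsLossLaw K) : compose (L :: l) = L.conv (compose l) := by
  have := hL.prob
  rw [← List.singleton_append, compose_append (by simpa using hL) hl]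
  congr 1
  simpa [idPLD_conv] using compose_concat [] L

lemma compose_singleton {L : Measure EReal} (hL : IsLossLaw L) : compose [L] = L := by
  have := hL.prob
  simpa [idPLD_conv] using compose_concat [] L

/-- Expectation commutes with the supremum of a chain of hockey-stick profiles. -/
lemma lintegral_iSup_hockeyStick {C : Set (Measure EReal)} (hC : ∀ L ∈ C, IsLossLaw L)
    (hchain : ∀ L ∈ C, ∀ L' ∈ C, (∀ γ, γ ≠ ∞ → hockeyStick L γ ≤ hockeyStick L' γ) ∨
      ∀ γ, γ ≠ ∞ → hockeyStick L' γ ≤ hockeyStick L γ)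
    {K : Measure EReal} (hK : IsLossLaw K) {γ : ℝ≥0∞} (hγ : γ ≠ ∞) :
    ∫⁻ l, ⨆ L ∈ C, hockeyStick L (γ * lossRatio l) ∂K ≤
      ⨆ L ∈ C, hockeyStick (K.conv L) γ := by
  -- The family may be uncountable, whereas monotone convergence needs a countable one. Countably
  -- many members attain the supremum at each rational slope, and the Lipschitz bound carries this
  -- over to every finite slope.
  have hdense : ∀ q : ℚ, ∃ s : Set (Measure EReal), s ⊆ C ∧ s.Countable ∧
      ⨆ L ∈ C, hockeyStick L (ENNReal.ofReal q) ≤ ⨆ L ∈ s, hockeyStick L (ENNReal.ofReal q) := by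
    intro q
    rcases C.eq_empty_or_nonempty with rfl | hne
    · exact ⟨∅, subset_rfl, Set.countable_empty, le_rfl⟩
    have := hne.to_subtype
    obtain ⟨u, -, hlim, hmem⟩ := exists_seq_tendsto_sSup
      (S := Set.range fun L : C => hockeyStick L.1 (ENNReal.ofReal q)) (Set.range_nonempty _)
      (OrderTop.bddAbove _)
    choose v hv using hmem
    refine ⟨Set.range fun n => (v n).1, ?_, Set.countable_range _, ?_⟩
    · rintro _ ⟨n, rfl⟩; exact (v n).2
    · rw [iSup_subtype', ← sSup_range]
      refine le_of_tendsto' hlim fun n => ?_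
      rw [← hv n]
      exact le_iSup₂_of_le (f := fun L (_ : L ∈ Set.range fun n => (v n).1) =>
        hockeyStick L (ENNReal.ofReal q)) (v n).1 ⟨n, rfl⟩ le_rfl
  choose s hsC hsc hs using hdense
  set D := ⋃ q, s q with hD
  have hDC : D ⊆ C := Set.iUnion_subset hsC
  have : Countable D := (Set.countable_iUnion hsc).to_subtype
  have hsup : ∀ x : ℝ≥0∞, x ≠ ∞ → ⨆ L ∈ C, hockeyStick L x ≤ ⨆ L : D, hockeyStick L.1 x := by
    intro x hx
    refine ENNReal.le_of_forall_pos_le_add fun ε hε _ => ?_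
    obtain ⟨q, hq1, hq2⟩ := exists_rat_btwn (show x.toReal < x.toReal + ε by
      linarith [NNReal.coe_pos.2 hε])
    have hxq : x ≤ ENNReal.ofReal q := by
      rw [← ENNReal.ofReal_toReal hx]; exact ENNReal.ofReal_le_ofReal hq1.le
    have hqx : ENNReal.ofReal q ≤ x + ε := by
      rw [← ENNReal.ofReal_toReal hx, ← ENNReal.ofReal_coe_nnreal (p := ε),
        ← ENNReal.ofReal_add ENNReal.toReal_nonneg (NNReal.coe_nonneg ε)]
      exact ENNReal.ofReal_le_ofReal hq2.le
    refine iSup₂_le fun L hL => ?_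
    calc hockeyStick L x ≤ hockeyStick L (ENNReal.ofReal q) + (ENNReal.ofReal q - x) :=
          (hC L hL).hockeyStick_le_add _ _
      _ ≤ (⨆ L : D, hockeyStick L.1 x) + ε := by
          gcongr
          · calc hockeyStick L (ENNReal.ofReal q)
                ≤ ⨆ L ∈ C, hockeyStick L (ENNReal.ofReal q) :=
                  le_iSup₂ (f := fun L (_ : L ∈ C) => hockeyStick L (ENNReal.ofReal q)) L hL
              _ ≤ ⨆ L ∈ s q, hockeyStick L (ENNReal.ofReal q) := hs q
              _ ≤ _ := iSup₂_le fun L' hL' => le_iSup_of_le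
                  (⟨L', Set.mem_iUnion_of_mem q hL'⟩ : D) (antitone_hockeyStick L' hxq)
          · exact tsub_le_iff_left.2 hqx
  have hfin : ∀ᵐ l ∂K, γ * lossRatio l ≠ ∞ := by
    filter_upwards [hK.ae_ne_bot] with l hl
    exact ENNReal.mul_ne_top hγ (by simpa [lossRatio_eq_top] using hl)
  calc ∫⁻ l, ⨆ L ∈ C, hockeyStick L (γ * lossRatio l) ∂K
      -- The chain condition speaks of finite slopes only. Setting the integrand to `0` at slope
      -- `∞`, a `K`-null event, makes the family directed everywhere.
      ≤ ∫⁻ l, ⨆ L : D, (if γ * lossRatio l = ∞ then 0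
          else hockeyStick L.1 (γ * lossRatio l)) ∂K := by
        refine lintegral_mono_ae ?_
        filter_upwards [hfin] with l hl
        simpa only [hl, if_false] using hsup _ hl
    _ = ⨆ L : D, ∫⁻ l, (if γ * lossRatio l = ∞ then 0
          else hockeyStick L.1 (γ * lossRatio l)) ∂K := by
        have hm := measurable_lossRatio
        refine lintegral_iSup_directed_of_measurable (fun L => ?_) ?_
        · exact Measurable.ite (measurableSet_eq_fun (by fun_prop) (by fun_prop)) measurable_const
            ((measurable_hockeyStick L.1).comp (by fun_prop))
        · intro L L'
          rcases hchain L.1 (hDC L.2) L'.1 (hDC L'.2) with h | h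
          · refine ⟨L', fun l => ?_, le_rfl⟩
            dsimp only
            split_ifs with h0
            · exact le_rfl
            · exact h _ h0
          · refine ⟨L, le_rfl, fun l => ?_⟩
            dsimp only
            split_ifs with h0
            · exact le_rfl
            · exact h _ h0
    _ ≤ ⨆ L ∈ C, hockeyStick (K.conv L) γ := by
        refine iSup_le fun L => ?_
        refine le_iSup₂_of_le (f := fun L (_ : L ∈ C) => hockeyStick (K.conv L) γ) L.1
          (hDC L.2) ?_
        rw [hK.hockeyStick_conv (hC L.1 (hDC L.2))]
        refine lintegral_mono fun l => ?_
        split_ifs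
        · exact zero_le
        · exact le_rfl

lemma measurable_iSup_hockeyStick (C : Set (Measure EReal)) :
    Measurable fun γ => ⨆ L ∈ C, hockeyStick L γ :=
  Antitone.measurable fun _ _ h => iSup₂_mono fun L _ => antitone_hockeyStick L h

/-! ### From kink functions to the convex order -/

section ConvexOrder

/-- Every point of `[0, 1]` lies in a cell of the uniform grid of mesh `1 / (m + 1)`. -/
lemma exists_grid_cell (m : ℕ) {x : ℝ} (h0 : 0 ≤ x) (h1 : x ≤ 1) :
    ∃ j ≤ m, (j : ℝ) / (m + 1) ≤ x ∧ x ≤ (j + 1 : ℝ) / (m + 1) := by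
  have hm : (0 : ℝ) < m + 1 := by positivity
  rcases h1.lt_or_eq with h | rfl
  · refine ⟨⌊x * (m + 1)⌋₊, ?_, ?_, ?_⟩
    · refine Nat.lt_succ_iff.1 ((Nat.floor_lt (by positivity)).2 ?_)
      push_cast
      nlinarith
    · rw [div_le_iff₀ hm]; exact Nat.floor_le (by positivity)
    · rw [le_div_iff₀ hm]; exact (Nat.lt_floor_add_one _).le
  · exact ⟨m, le_rfl, by rw [div_le_one hm]; linarith, by rw [div_self hm.ne']⟩

/-- The slope of `S` on the `i`-th cell of the uniform grid of mesh `1 / (m + 1)`. -/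
noncomputable def gridSlope (S : ℝ → ℝ) (m i : ℕ) : ℝ :=
  (m + 1) * (S ((i + 1) / (m + 1)) - S (i / (m + 1)))

/-- The piecewise linear interpolation of `S` on the uniform grid of mesh `1 / (m + 1)`. -/
noncomputable def gridInterpolation (S : ℝ → ℝ) (m : ℕ) (x : ℝ) : ℝ :=
  S 0 + gridSlope S m 0 * x + ∑ i ∈ Finset.range m,
    (gridSlope S m (i + 1) - gridSlope S m i) * max (x - (i + 1) / (m + 1)) 0

/-- On the `j`-th cell exactly the kinks with index below `j` are active, and their slope increments
telescope to the slope of that cell. -/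
lemma gridInterpolation_eq (S : ℝ → ℝ) {m j : ℕ} (hj : j ≤ m) {x : ℝ}
    (h0 : (j : ℝ) / (m + 1) ≤ x) (h1 : x ≤ (j + 1 : ℝ) / (m + 1)) :
    gridInterpolation S m x = S (j / (m + 1)) + gridSlope S m j * (x - j / (m + 1)) := by
  have hm : (0 : ℝ) < m + 1 := by positivity
  have hsum : ∑ i ∈ Finset.range m,
      (gridSlope S m (i + 1) - gridSlope S m i) * max (x - (i + 1) / (m + 1)) 0 =
      ∑ i ∈ Finset.range j,
      (gridSlope S m (i + 1) - gridSlope S m i) * (x - (i + 1) / (m + 1)) := by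
    rw [← Finset.sum_subset (Finset.range_mono hj)]
    · refine Finset.sum_congr rfl fun i hi => ?_
      rw [max_eq_left]
      have : ((i : ℝ) + 1) / (m + 1) ≤ j / (m + 1) := by
        gcongr; exact_mod_cast Finset.mem_range.1 hi
      linarith
    · intro i _ hi
      have hi : j ≤ i := by simpa using hi
      have : ((j : ℝ) + 1) / (m + 1) ≤ (i + 1) / (m + 1) := by gcongr
      rw [max_eq_right (by linarith), mul_zero]
  rw [gridInterpolation, hsum]
  clear hsum h0 h1 hj
  induction j with
  | zero => simp
  | succ j ih =>
    rw [Finset.sum_range_succ, ← add_assoc, ih]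
    simp only [gridSlope]
    push_cast
    field_simp
    ring

lemma abs_gridInterpolation_sub_le (S : ℝ → ℝ) (m : ℕ) {ε : ℝ}
    (hS : ∀ x ∈ Set.Icc (0 : ℝ) 1, ∀ y ∈ Set.Icc (0 : ℝ) 1, |x - y| ≤ 1 / (m + 1) →
      |S x - S y| ≤ ε) {x : ℝ} (hx : x ∈ Set.Icc (0 : ℝ) 1) :
    |gridInterpolation S m x - S x| ≤ ε := by
  have hm : (0 : ℝ) < m + 1 := by positivity
  obtain ⟨j, hj, h0, h1⟩ := exists_grid_cell m hx.1 hx.2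
  rw [gridInterpolation_eq S hj h0 h1]
  set a : ℝ := j / (m + 1) with ha
  set b : ℝ := (j + 1) / (m + 1) with hb
  have hab : b - a = 1 / (m + 1) := by rw [ha, hb]; ring
  have ha0 : 0 ≤ a := by positivity
  have hb1 : b ≤ 1 := by
    rw [hb, div_le_one hm]; have : (j : ℝ) ≤ m := by exact_mod_cast hj
    linarith
  set θ : ℝ := (m + 1) * (x - a) with hθ
  have hθ0 : 0 ≤ θ := mul_nonneg hm.le (by linarith)
  have hθ1 : θ ≤ 1 := by
    rw [hθ, mul_comm, ← le_div_iff₀ hm]; linarith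
  have h2 := abs_le.1 (hS a ⟨ha0, by linarith⟩ x hx (by rw [abs_le]; constructor <;> linarith))
  have h3 := abs_le.1 (hS b ⟨by linarith, hb1⟩ x hx (by rw [abs_le]; constructor <;> linarith))
  have key : S a + gridSlope S m j * (x - a) - S x =
      (1 - θ) * (S a - S x) + θ * (S b - S x) := by
    rw [gridSlope, hθ]; ring
  rw [key, abs_le]
  constructor <;> nlinarith

lemma gridSlope_le_succ {S : ℝ → ℝ} (hS : ConvexOn ℝ Set.univ S) (m i : ℕ) :
    gridSlope S m i ≤ gridSlope S m (i + 1) := by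
  have hm : (0 : ℝ) < m + 1 := by positivity
  have h := hS.2 (Set.mem_univ ((i : ℝ) / (m + 1))) (Set.mem_univ (((i : ℝ) + 1 + 1) / (m + 1)))
    (show (0 : ℝ) ≤ 1 / 2 by norm_num) (show (0 : ℝ) ≤ 1 / 2 by norm_num) (by norm_num)
  have he : (1 / 2 : ℝ) • ((i : ℝ) / (m + 1)) + (1 / 2 : ℝ) • (((i : ℝ) + 1 + 1) / (m + 1)) =
      (i + 1) / (m + 1) := by
    simp only [smul_eq_mul]; field_simp; ring
  rw [he] at h
  simp only [smul_eq_mul] at h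
  simp only [gridSlope]
  push_cast
  nlinarith

variable {X : Type*} [MeasurableSpace X] {N N' : Measure X} [IsFiniteMeasure N]
  [IsFiniteMeasure N']

lemma integrable_comp_of_continuous {M : Measure X} [IsFiniteMeasure M] {w : X → ℝ}
    (hw : Measurable w) (h01 : ∀ x, w x ∈ Set.Icc (0 : ℝ) 1) {S : ℝ → ℝ} (hS : Continuous S) :
    Integrable (fun x => S (w x)) M := by
  obtain ⟨C, hC⟩ := isCompact_Icc.exists_bound_of_continuousOn (hS.continuousOn (s := Set.Icc 0 1))
  exact Integrable.of_bound (hS.measurable.comp hw).aestronglyMeasurable C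
    (ae_of_all _ fun x => hC _ (h01 x))

/-- Two laws on `[0, 1]` with equal masses and means that are ordered on the functions
`x ↦ (x - t)⁺` are in the convex order. -/
lemma integral_le_integral_of_convexOn {w : X → ℝ} (hw : Measurable w)
    (h01 : ∀ x, w x ∈ Set.Icc (0 : ℝ) 1) (hmass : N.real Set.univ = N'.real Set.univ)
    (hmean : ∫ x, w x ∂N = ∫ x, w x ∂N')
    (hkink : ∀ t, 0 ≤ t → t < 1 → ∫ x, max (w x - t) 0 ∂N ≤ ∫ x, max (w x - t) 0 ∂N')
    {S : ℝ → ℝ} (hSc : Continuous S) (hS : ConvexOn ℝ Set.univ S) :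
    ∫ x, S (w x) ∂N ≤ ∫ x, S (w x) ∂N' := by
  have hTc : ∀ m, Continuous (gridInterpolation S m) := fun m => by
    unfold gridInterpolation; fun_prop
  have hT : ∀ m, ∫ x, gridInterpolation S m (w x) ∂N ≤ ∫ x, gridInterpolation S m (w x) ∂N' := by
    intro m
    have hexp : ∀ (M : Measure X) [IsFiniteMeasure M], ∫ x, gridInterpolation S m (w x) ∂M =
        M.real Set.univ * S 0 + gridSlope S m 0 * ∫ x, w x ∂M + ∑ i ∈ Finset.range m,
          (gridSlope S m (i + 1) - gridSlope S m i) *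
            ∫ x, max (w x - (i + 1) / (m + 1)) 0 ∂M := by
      intro M _
      have hi : ∀ {F : ℝ → ℝ}, Continuous F → Integrable (fun x => F (w x)) M := fun hF =>
        integrable_comp_of_continuous hw h01 hF
      simp only [gridInterpolation]
      rw [integral_add, integral_add, integral_finsetSum, integral_const, integral_const_mul]
      · simp only [integral_const_mul, smul_eq_mul]
      · intro i _
        exact hi (F := fun y => (gridSlope S m (i + 1) - gridSlope S m i) *
          max (y - (i + 1) / (m + 1)) 0) (by fun_prop)
      · exact integrable_const _
      · exact hi (F := fun y => gridSlope S m 0 * y) (by fun_prop)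
      · exact hi (F := fun y => S 0 + gridSlope S m 0 * y) (by fun_prop)
      · exact hi (F := fun y => ∑ i ∈ Finset.range m, (gridSlope S m (i + 1) - gridSlope S m i) *
          max (y - (i + 1) / (m + 1)) 0) (by fun_prop)
    rw [hexp N, hexp N', hmass, hmean]
    -- The affine part agrees by equality of masses and means; each kink enters with a slope
    -- increment, nonnegative by convexity.
    refine add_le_add le_rfl (Finset.sum_le_sum fun i hi =>
      mul_le_mul_of_nonneg_left (hkink _ (by positivity) ?_)
        (sub_nonneg.2 (gridSlope_le_succ hS m i)))
    rw [div_lt_one (by positivity)]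
    have : (i : ℝ) < m := by exact_mod_cast Finset.mem_range.1 hi
    linarith
  refine le_of_forall_pos_le_add fun ε hε => ?_
  set c := N'.real Set.univ with hc
  have hc0 : 0 ≤ c := measureReal_nonneg
  -- Interpolation costs `c * δ` on each side; `c + 1` replaces `c` to avoid division by zero.
  set δ := ε / (2 * (c + 1)) with hδ
  have hδ0 : 0 < δ := by positivity
  obtain ⟨η, hη, hu⟩ := Metric.uniformContinuousOn_iff_le.1
    (isCompact_Icc.uniformContinuousOn_of_continuous (hSc.continuousOn (s := Set.Icc 0 1))) δ hδ0
  obtain ⟨m, hm⟩ := exists_nat_one_div_lt hη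
  have happ : ∀ x ∈ Set.Icc (0 : ℝ) 1, |gridInterpolation S m x - S x| ≤ δ := fun x hx =>
    abs_gridInterpolation_sub_le S m (fun x hx y hy hxy => hu x hx y hy (hxy.trans hm.le)) hx
  have hS1 : ∀ (M : Measure X) [IsFiniteMeasure M], Integrable (fun x => S (w x)) M :=
    fun M _ => integrable_comp_of_continuous hw h01 hSc
  have hT1 : ∀ (M : Measure X) [IsFiniteMeasure M],
      Integrable (fun x => gridInterpolation S m (w x)) M :=
    fun M _ => integrable_comp_of_continuous hw h01 (hTc m)
  have e1 : ∫ x, S (w x) ∂N ≤ ∫ x, gridInterpolation S m (w x) ∂N + c * δ := by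
    rw [← hmass, ← smul_eq_mul, ← integral_const, ← integral_add (hT1 N) (integrable_const _)]
    refine integral_mono (hS1 N) ((hT1 N).add (integrable_const _)) fun x => ?_
    have := abs_le.1 (happ _ (h01 x))
    simp only; linarith
  have e2 : ∫ x, gridInterpolation S m (w x) ∂N' ≤ ∫ x, S (w x) ∂N' + c * δ := by
    rw [hc, ← smul_eq_mul, ← integral_const, ← integral_add (hS1 N') (integrable_const _)]
    refine integral_mono (hT1 N') ((hS1 N').add (integrable_const _)) fun x => ?_
    have := abs_le.1 (happ _ (h01 x))
    simp only; linarith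
  have e3 : 2 * (c * δ) ≤ ε := by
    have : 2 * ((c + 1) * δ) = ε := by rw [hδ]; field_simp
    nlinarith
  linarith [hT m]

end ConvexOrder

/-! ### Garbling kernels from Hahn-Banach and Riesz representation -/

section Strassen

lemma sSup_section_le {X : Type*} [TopologicalSpace X] [Nonempty X] (F : C(X × X, ℝ)) (x : X) {c : ℝ}
    (h : ∀ y, F (x, y) ≤ c) : sSup ((fun y => F (x, y)) '' Set.univ) ≤ c :=
  csSup_le (Set.univ_nonempty.image _) (by rintro _ ⟨y, -, rfl⟩; exact h y)

variable {X : Type*} [TopologicalSpace X] [CompactSpace X]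

lemma continuous_sSup_section (F : C(X × X, ℝ)) :
    Continuous fun x => sSup ((fun y => F (x, y)) '' Set.univ) :=
  isCompact_univ.continuous_sSup (f := fun x y => F (x, y)) (by
    have := F.continuous
    exact this)

lemma le_sSup_section (F : C(X × X, ℝ)) (x y : X) :
    F (x, y) ≤ sSup ((fun y => F (x, y)) '' Set.univ) :=
  le_csSup (isCompact_univ.bddAbove_image (by fun_prop)) ⟨y, Set.mem_univ y, rfl⟩

variable [MeasurableSpace X] [BorelSpace X] [PolishSpace X] {N N' : Measure X}
  [IsFiniteMeasure N] [IsFiniteMeasure N']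

lemma integrable_of_continuous {Y : Type*} [TopologicalSpace Y] [CompactSpace Y]
    [MeasurableSpace Y] [OpensMeasurableSpace Y] {M : Measure Y} [IsFiniteMeasure M] {f : Y → ℝ}
    (hf : Continuous f) : Integrable f M := by
  obtain ⟨C, hC⟩ := isCompact_univ.exists_bound_of_continuousOn hf.continuousOn
  exact Integrable.of_bound hf.measurable.aestronglyMeasurable C
    (ae_of_all _ fun x => hC x (Set.mem_univ x))

/-- Riesz representation for positive functionals on `C(Y, ℝ)`, `Y` compact. -/
lemma exists_measure_of_nonneg {Y : Type*} [TopologicalSpace Y] [CompactSpace Y] [T2Space Y]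
    [MeasurableSpace Y] [BorelSpace Y] (Λ : C(Y, ℝ) →ₗ[ℝ] ℝ) (hΛ : ∀ F, (∀ y, 0 ≤ F y) → 0 ≤ Λ F) :
    ∃ π : Measure Y, IsFiniteMeasure π ∧ ∀ F : C(Y, ℝ), ∫ y, F y ∂π = Λ F := by
  let Λ₀ : CompactlySupportedContinuousMap Y ℝ →ₗ[ℝ] ℝ :=
    { toFun := fun F => Λ F.toContinuousMap
      map_add' := fun F G => Λ.map_add F.toContinuousMap G.toContinuousMap
      map_smul' := fun c F => Λ.map_smul c F.toContinuousMap }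
  let Λ₁ := PositiveLinearMap.mk₀ Λ₀ fun F hF => hΛ _ hF
  refine ⟨RealRMK.rieszMeasure Λ₁, inferInstance, fun F => ?_⟩
  exact RealRMK.integral_rieszMeasure Λ₁ ⟨F, HasCompactSupport.of_compactSpace _⟩

/-- A dichotomy is garbled into another one as soon as it is better in every decision problem.
Both dichotomies live on `X`, with total masses `N`, `N'` and posterior `w`. -/
lemma exists_kernel_of_integral_le [Nonempty X] (w : C(X, ℝ)) {a b : X} (ha : w a = 1)
    (hb : w b = 0)
    (H : ∀ g h : C(X, ℝ), ∫ y, (w y * g y + (1 - w y) * h y) ∂N ≤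
      ∫ x, sSup ((fun y => w x * g y + (1 - w x) * h y) '' Set.univ) ∂N') :
    ∃ φ : Kernel X X, IsMarkovKernel φ ∧ ∀ g : C(X, ℝ),
      ∫ x, w x * ∫ y, g y ∂(φ x) ∂N' = ∫ y, w y * g y ∂N ∧
      ∫ x, (1 - w x) * ∫ y, g y ∂(φ x) ∂N' = ∫ y, (1 - w y) * g y ∂N := by
  -- The kernel will be read off a coupling `π` with first marginal `N'`. The functional `p` bounds
  -- the integral of `F` against every such coupling.
  let p : C(X × X, ℝ) → ℝ := fun F => ∫ x, sSup ((fun y => F (x, y)) '' Set.univ) ∂N'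
  have hint : ∀ F : C(X × X, ℝ),
      Integrable (fun x => sSup ((fun y => F (x, y)) '' Set.univ)) N' := fun F =>
    integrable_of_continuous (continuous_sSup_section F)
  -- On payoffs affine in the posterior `w x`, the two garbling identities prescribe the value of
  -- the coupling. The points `a`, `b`, where `w` is `1` and `0`, recover the two coefficients, and
  -- `H` says that the prescribed value is at most `p`.
  let V : Submodule ℝ C(X × X, ℝ) :=
    { carrier := {F | ∀ x y, F (x, y) = w x * F (a, y) + (1 - w x) * F (b, y)}
      zero_mem' := by intro x y; simp
      add_mem' := by
        intro F G hF hG x y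
        simp only [ContinuousMap.add_apply]
        rw [hF x y, hG x y]; ring
      smul_mem' := by
        intro c F hF x y
        simp only [ContinuousMap.smul_apply, smul_eq_mul]
        rw [hF x y]; ring }
  have hint0 : ∀ F : C(X × X, ℝ),
      Integrable (fun y => w y * F (a, y) + (1 - w y) * F (b, y)) N := fun F =>
    integrable_of_continuous (by fun_prop)
  let f₀ : C(X × X, ℝ) →ₗ[ℝ] ℝ :=
    { toFun := fun F => ∫ y, (w y * F (a, y) + (1 - w y) * F (b, y)) ∂N
      map_add' := by
        intro F G
        rw [← integral_add (hint0 F) (hint0 G)]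
        refine integral_congr_ae (ae_of_all _ fun y => ?_)
        simp only [ContinuousMap.add_apply]; ring
      map_smul' := by
        intro c F
        rw [RingHom.id_apply, smul_eq_mul, ← integral_const_mul]
        refine integral_congr_ae (ae_of_all _ fun y => ?_)
        simp only [ContinuousMap.smul_apply, smul_eq_mul]; ring }
  obtain ⟨Λ, hΛV, hΛp⟩ := exists_extension_of_le_sublinear ⟨V, f₀.domRestrict V⟩ p
    (by
      intro c hc F
      simp only [p]
      rw [← integral_const_mul]
      refine integral_congr_ae (ae_of_all _ fun x => ?_)
      refine le_antisymm (sSup_section_le _ x fun y => ?_) ?_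
      · exact mul_le_mul_of_nonneg_left (le_sSup_section F x y) hc.le
      · rw [← le_div_iff₀' hc]
        refine sSup_section_le _ x fun y => ?_
        rw [le_div_iff₀' hc]
        exact le_sSup_section (c • F) x y)
    (by
      intro F G
      simp only [p]
      rw [← integral_add (hint F) (hint G)]
      refine integral_mono (hint _) ((hint F).add (hint G)) fun x => ?_
      exact sSup_section_le _ x fun y => add_le_add (le_sSup_section F x y) (le_sSup_section G x y))
    (by
      rintro ⟨F, hF⟩
      have := H ⟨fun y => F (a, y), by fun_prop⟩ ⟨fun y => F (b, y), by fun_prop⟩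
      refine this.trans_eq ?_
      refine integral_congr_ae (ae_of_all _ fun x => ?_)
      simp only [ContinuousMap.coe_mk]
      congr 1
      refine Set.image_congr fun y _ => ?_
      exact (hF x y).symm)
  obtain ⟨π, _, hπ⟩ := exists_measure_of_nonneg Λ (by
    intro F hF
    have h1 := hΛp (-F)
    have h2 : p (-F) ≤ 0 := integral_nonpos fun x => sSup_section_le _ x fun y => by
      simpa using hF (x, y)
    rw [map_neg] at h1
    linarith)
  -- On functions of the first coordinate `p` is linear, so the bound by `p` applied to `f` and `-f`
  -- fixes the marginal.
  have hfst : π.fst = N' := by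
    have hle : ∀ f : C(X, ℝ), ∫ x, f x ∂π.fst ≤ ∫ x, f x ∂N' := by
      intro f
      have h1 := hπ (f.comp ContinuousMap.fst)
      have h2 := hΛp (f.comp ContinuousMap.fst)
      rw [Measure.fst, integral_map measurable_fst.aemeasurable
        f.continuous.measurable.aestronglyMeasurable]
      refine (h1.trans_le h2).trans_eq (integral_congr_ae (ae_of_all _ fun x => ?_))
      exact le_antisymm (sSup_section_le _ x fun y => le_rfl)
        (le_sSup_section (f.comp ContinuousMap.fst) x x)
    refine ext_of_forall_integral_eq_of_IsFiniteMeasure fun f => ?_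
    refine le_antisymm (hle f.toContinuousMap) ?_
    have := hle (-f.toContinuousMap)
    simp only [ContinuousMap.neg_apply, integral_neg, neg_le_neg_iff] at this
    exact this
  refine ⟨π.condKernel, inferInstance, fun g => ?_⟩
  have hdis : ∀ c : C(X, ℝ), (∀ x, c x = w x * c a + (1 - w x) * c b) →
      ∫ x, c x * ∫ y, g y ∂(π.condKernel x) ∂N' =
        ∫ y, (w y * (c a * g y) + (1 - w y) * (c b * g y)) ∂N := by
    intro c hc
    -- Product payoffs `c x * g y` with `c` affine in `w` lie in `V`; the choices `c = w` and `c = 1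
    -- - w` give the two identities.
    let F : C(X × X, ℝ) := ⟨fun z => c z.1 * g z.2, by fun_prop⟩
    have hF : F ∈ V := fun x y => by
      simp only [F, ContinuousMap.coe_mk]
      rw [hc x]; ring
    have h1 : Λ F = ∫ y, (w y * (c a * g y) + (1 - w y) * (c b * g y)) ∂N := hΛV ⟨F, hF⟩
    rw [← h1, ← hπ F]
    conv_rhs => rw [← Measure.disintegrate π π.condKernel]
    rw [Measure.integral_compProd, hfst]
    · refine integral_congr_ae (ae_of_all _ fun x => ?_)
      exact (integral_const_mul _ _).symm
    · rw [Measure.disintegrate]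
      exact integrable_of_continuous F.continuous
  constructor
  · simpa [ha, hb] using hdis w (by simp [ha, hb])
  · simpa [ha, hb] using hdis (1 - w) (by simp [ha, hb])

end Strassen

/-! ### Blackwell's theorem for privacy loss distributions -/

/-- The posterior probability of the first hypothesis, from a uniform prior, as a function of the
privacy loss. -/
noncomputable def posterior (l : EReal) : ℝ := ((1 + lossRatio l)⁻¹).toReal

lemma inv_one_add_le_one (x : ℝ≥0∞) : (1 + x)⁻¹ ≤ 1 := ENNReal.inv_le_one.2 le_self_add

lemma continuous_posterior : Continuous posterior := by
  refine ENNReal.continuousOn_toReal.comp_continuous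
    (continuous_inv.comp (continuous_const.add continuous_lossRatio)) fun l => ?_
  exact ((inv_one_add_le_one _).trans_lt ENNReal.one_lt_top).ne

lemma ofReal_posterior (l : EReal) : ENNReal.ofReal (posterior l) = (1 + lossRatio l)⁻¹ :=
  ENNReal.ofReal_toReal ((inv_one_add_le_one _).trans_lt ENNReal.one_lt_top).ne

lemma posterior_mem (l : EReal) : posterior l ∈ Set.Icc (0 : ℝ) 1 :=
  ⟨ENNReal.toReal_nonneg, ENNReal.toReal_le_of_le_ofReal zero_le_one
    (by simp)⟩

@[simp] lemma posterior_top : posterior ⊤ = 1 := by simp [posterior]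

@[simp] lemma posterior_bot : posterior ⊥ = 0 := by simp [posterior]

lemma posterior_eq {l : EReal} (hl : l ≠ ⊥) : posterior l = 1 / (1 + (lossRatio l).toReal) := by
  have : lossRatio l ≠ ∞ := by simpa [lossRatio_eq_top] using hl
  rw [posterior, ENNReal.toReal_inv, ENNReal.toReal_add ENNReal.one_ne_top this]
  simp

/-- A threshold `t` on the posterior is the slope `t / (1 - t)` on the likelihood ratio, by passage
from probability to odds. At `⊥` both sides vanish. -/
lemma ofReal_max_posterior_sub (l : EReal) {t : ℝ} (h0 : 0 ≤ t) (h1 : t < 1) :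
    ENNReal.ofReal (max (posterior l - t) 0) =
      ENNReal.ofReal (1 - t) * ((1 - ENNReal.ofReal (t / (1 - t)) * lossRatio l) *
        ENNReal.ofReal (posterior l)) := by
  by_cases hl : l = ⊥
  · subst hl
    simp [h0]
  have ht : lossRatio l ≠ ∞ := by simpa [lossRatio_eq_top] using hl
  set ρ := (lossRatio l).toReal with hρ
  have hρ0 : 0 ≤ ρ := ENNReal.toReal_nonneg
  have ht1 : 0 < 1 - t := by linarith
  rw [posterior_eq hl, ← hρ, ← ENNReal.ofReal_toReal ht, ← hρ, ← ENNReal.ofReal_mul (by positivity),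
    ← ENNReal.ofReal_one, ← ENNReal.ofReal_sub _ (by positivity),
    ← ENNReal.ofReal_mul' (by positivity), ← ENNReal.ofReal_mul ht1.le]
  have key : (1 - t) * ((1 - t / (1 - t) * ρ) * (1 / (1 + ρ))) = 1 / (1 + ρ) - t := by
    field_simp
    ring
  rw [key]
  rcases le_total 0 (1 / (1 + ρ) - t) with h | h
  · rw [max_eq_left h]
  · rw [max_eq_right h, ENNReal.ofReal_zero, ENNReal.ofReal_of_nonpos h]

namespace IsLossLaw

variable {L L' : Measure EReal}

/-- Bayes' rule: the weight `1 + lossRatio l` coming from the two hypotheses cancels the posterior,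
and the atom of `dualLaw L` at `⊥` has posterior `0`. -/
lemma withDensity_posterior (hL : IsLossLaw L) :
    (L + dualLaw L).withDensity (fun l => ENNReal.ofReal (posterior l)) = L := by
  have hm := measurable_lossRatio
  have hw : Measurable fun l => ENNReal.ofReal (posterior l) :=
    continuous_posterior.measurable.ennreal_ofReal
  refine Measure.ext_of_lintegral _ fun f hf => ?_
  rw [lintegral_withDensity_eq_lintegral_mul _ hw hf, lintegral_add_measure,
    lintegral_dualLaw L (hw.mul hf) (by simp), ← lintegral_add_left (hw.mul hf)]
  refine lintegral_congr_ae ?_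
  filter_upwards [hL.ae_ne_bot] with l hl
  have ht : lossRatio l ≠ ∞ := by simpa [lossRatio_eq_top] using hl
  simp only [Pi.mul_apply, ofReal_posterior]
  calc (1 + lossRatio l)⁻¹ * f l + (1 + lossRatio l)⁻¹ * f l * lossRatio l
      = (1 + lossRatio l)⁻¹ * (1 + lossRatio l) * f l := by ring
    _ = f l := by
      rw [ENNReal.inv_mul_cancel (by simp) (by simp [ht]), one_mul]

lemma integral_posterior_mul (hL : IsLossLaw L) (g : EReal → ℝ) :
    ∫ l, posterior l * g l ∂(L + dualLaw L) = ∫ l, g l ∂L := by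
  conv_rhs => rw [← hL.withDensity_posterior]
  rw [integral_withDensity_eq_integral_toReal_smul
    continuous_posterior.measurable.ennreal_ofReal (ae_of_all _ fun l => ENNReal.ofReal_lt_top)]
  refine integral_congr_ae (ae_of_all _ fun l => ?_)
  simp only [smul_eq_mul, ENNReal.toReal_ofReal (posterior_mem l).1]

lemma integral_one_sub_posterior_mul (hL : IsLossLaw L) {g : EReal → ℝ}
    (hg : Integrable g (L + dualLaw L)) :
    ∫ l, (1 - posterior l) * g l ∂(L + dualLaw L) = ∫ l, g l ∂(dualLaw L) := by
  have := hL.prob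
  have := hL.isProbabilityMeasure_dualLaw
  have hc := continuous_posterior
  have hw : Integrable (fun l => posterior l * g l) (L + dualLaw L) :=
    hg.bdd_mul (c := 1) hc.measurable.aestronglyMeasurable (ae_of_all _ fun l => by
      rw [Real.norm_of_nonneg (posterior_mem l).1]; exact (posterior_mem l).2)
  simp only [sub_mul, one_mul]
  rw [integral_sub hg hw, hL.integral_posterior_mul,
    integral_add_measure hg.left_of_add_measure hg.right_of_add_measure]
  ring

lemma integral_max_posterior_sub (hL : IsLossLaw L) {t : ℝ} (h0 : 0 ≤ t) (h1 : t < 1) :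
    ∫ l, max (posterior l - t) 0 ∂(L + dualLaw L) =
      (1 - t) * (hockeyStick L (ENNReal.ofReal (t / (1 - t)))).toReal := by
  have hm := measurable_lossRatio
  have hw : Measurable fun l => ENNReal.ofReal (posterior l) :=
    continuous_posterior.measurable.ennreal_ofReal
  have hc : Continuous fun l => max (posterior l - t) 0 := by
    have := continuous_posterior
    fun_prop
  rw [integral_eq_lintegral_of_nonneg_ae (f := fun l => max (posterior l - t) 0)
    (ae_of_all _ fun l => le_max_right _ _) hc.measurable.aestronglyMeasurable]
  simp only [ofReal_max_posterior_sub _ h0 h1]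
  have hM : Measurable fun l => 1 - ENNReal.ofReal (t / (1 - t)) * lossRatio l := by fun_prop
  rw [lintegral_const_mul _ (by fun_prop), ENNReal.toReal_mul, ENNReal.toReal_ofReal (by linarith)]
  congr 2
  conv_rhs => rw [hockeyStick, ← hL.withDensity_posterior,
    lintegral_withDensity_eq_lintegral_mul _ hw hM]
  simp [mul_comm]

lemma pldLE_of_hockeyStick_le (hL : IsLossLaw L) (hL' : IsLossLaw L')
    (h : ∀ γ, γ ≠ ∞ → hockeyStick L γ ≤ hockeyStick L' γ) : PLDLE L L' := by
  have := hL.prob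
  have := hL'.prob
  have := hL.isProbabilityMeasure_dualLaw
  have := hL'.isProbabilityMeasure_dualLaw
  set N := L + dualLaw L with hN
  set N' := L' + dualLaw L' with hN'
  have hc := continuous_posterior
  have hconv : ∀ S : ℝ → ℝ, Continuous S → ConvexOn ℝ Set.univ S →
      ∫ l, S (posterior l) ∂N ≤ ∫ l, S (posterior l) ∂N' := fun S hS1 hS2 => by
    -- The two mixtures have mass `2` and mean posterior mass `1`; their kink integrals are rescaled
    -- hockey-stick values.
    refine integral_le_integral_of_convexOn hc.measurable posterior_mem ?_ ?_ ?_ hS1 hS2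
    · simp [hN, hN', measureReal_add_apply]
    · have h1 := hL.integral_posterior_mul fun _ => 1
      have h2 := hL'.integral_posterior_mul fun _ => 1
      simp only [mul_one] at h1 h2
      rw [h1, h2]; simp
    · intro t h0 h1
      rw [hL.integral_max_posterior_sub h0 h1, hL'.integral_max_posterior_sub h0 h1]
      exact mul_le_mul_of_nonneg_left (ENNReal.toReal_mono (hL'.hockeyStick_ne_top _)
        (h _ ENNReal.ofReal_ne_top)) (by linarith)
  obtain ⟨φ, hφ, hg⟩ := exists_kernel_of_integral_le (N := N) (N' := N') ⟨posterior, hc⟩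
    posterior_top posterior_bot (by
      intro g k
      simp only [ContinuousMap.coe_mk]
      -- The optimal value of the decision problem with payoffs `g`, `k` as a function of the
      -- posterior, convex as a supremum of affine functions.
      set S : ℝ → ℝ := fun x => sSup ((fun y => x * g y + (1 - x) * k y) '' Set.univ) with hSdef
      have hSc : Continuous S := isCompact_univ.continuous_sSup
        (f := fun (x : ℝ) (y : EReal) => x * g y + (1 - x) * k y) (by
          simp only [Function.HasUncurry.uncurry, id]; fun_prop)
      have hle : ∀ (x : ℝ) y, x * g y + (1 - x) * k y ≤ S x := fun x y =>
        le_csSup (isCompact_univ.bddAbove_image (by fun_prop)) ⟨y, Set.mem_univ y, rfl⟩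
      have hSv : ConvexOn ℝ Set.univ S := by
        refine ⟨convex_univ, fun x _ y _ α β hα hβ hαβ => ?_⟩
        refine csSup_le (Set.univ_nonempty.image _) ?_
        rintro _ ⟨z, -, rfl⟩
        have h1 := mul_le_mul_of_nonneg_left (hle x z) hα
        have h2 := mul_le_mul_of_nonneg_left (hle y z) hβ
        simp only [smul_eq_mul]
        have : (α * x + β * y) * g z + (1 - (α * x + β * y)) * k z =
            α * (x * g z + (1 - x) * k z) + β * (y * g z + (1 - y) * k z) := by
          linear_combination (-k z) * hαβ
        linarith
      calc ∫ y, (posterior y * g y + (1 - posterior y) * k y) ∂N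
          ≤ ∫ y, S (posterior y) ∂N :=
            integral_mono (integrable_of_continuous (by fun_prop))
              (integrable_of_continuous (hSc.comp hc)) fun y => hle _ y
        _ ≤ ∫ y, S (posterior y) ∂N' := hconv S hSc hSv)
  have hbind : ∀ (M : Measure EReal) [IsProbabilityMeasure M] (g : BoundedContinuousFunction EReal ℝ),
      ∫ l, g l ∂(M.bind φ) = ∫ l, ∫ l', g l' ∂(φ l) ∂M := fun M _ g => by
    rw [← Measure.snd_compProd, Measure.snd, integral_map measurable_snd.aemeasurable
      g.continuous.measurable.aestronglyMeasurable, Measure.integral_compProd]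
    exact integrable_of_continuous (g.continuous.comp continuous_snd)
  refine ⟨EReal, EReal, inferInstance, inferInstance, L, dualLaw L, L', dualLaw L', hL.prob,
    inferInstance, hL'.prob, inferInstance, hL.pld_dualLaw, hL'.pld_dualLaw, φ, hφ, ?_, ?_⟩
  · refine ext_of_forall_integral_eq_of_IsFiniteMeasure fun g => ?_
    rw [hbind L' g, ← hL.integral_posterior_mul, ← hL'.integral_posterior_mul]
    exact (hg g.toContinuousMap).1.symm
  · refine ext_of_forall_integral_eq_of_IsFiniteMeasure fun g => ?_
    have hφg : Integrable (fun l => ∫ l', g l' ∂(φ l)) N' := by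
      refine Integrable.of_bound
        (g.continuous.stronglyMeasurable.integral_kernel (κ := φ)).aestronglyMeasurable ‖g‖
        (ae_of_all _ fun l => ?_)
      refine (norm_integral_le_of_norm_le_const (ae_of_all _ g.norm_coe_le_norm)).trans ?_
      simp
    rw [hbind (dualLaw L') g, ← hL.integral_one_sub_posterior_mul
      (integrable_of_continuous g.continuous), ← hL'.integral_one_sub_posterior_mul hφg]
    exact (hg g.toContinuousMap).2.symm

end IsLossLaw

/-- Blackwell's theorem for privacy loss distributions: the garbling order is the pointwise order
of the hockey-stick profiles. -/
lemma pldLE_iff {L L' : Measure EReal} (hL : IsLossLaw L) (hL' : IsLossLaw L') :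
    PLDLE L L' ↔ ∀ γ, γ ≠ ∞ → hockeyStick L γ ≤ hockeyStick L' γ :=
  ⟨fun h _ hγ => hockeyStick_le_of_pldLE h hγ, hL.pldLE_of_hockeyStick_le hL'⟩

/-! ### Transcripts and backward induction: a chain makes the filter free -/

section Transcript

variable {Y : ℕ → Type u} [∀ i, MeasurableSpace (Y i)]

/-- Extension of a transcript by one more output. -/
def History.snoc {n : ℕ} (h : History Y n) (y : Y n) : History Y (n + 1) :=
  ((h, y) : History Y n × Y n)

lemma History.measurable_snoc {n : ℕ} :
    Measurable fun z : History Y n × Y n => History.snoc z.1 z.2 :=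
  measurable_id

instance isProbabilityMeasure_transcriptLaw (κ : ∀ i, Kernel (History Y i) (Y i))
    [∀ i, IsMarkovKernel (κ i)] : ∀ n, IsProbabilityMeasure (transcriptLaw κ n)
  | 0 => (inferInstance : IsProbabilityMeasure (Measure.dirac PUnit.unit : Measure PUnit))
  | n + 1 =>
    have := isProbabilityMeasure_transcriptLaw κ n
    (inferInstance : IsProbabilityMeasure ((transcriptLaw κ n).compProd (κ n)))

lemma lintegral_transcriptLaw_zero (κ : ∀ i, Kernel (History Y i) (Y i))
    (f : History Y 0 → ℝ≥0∞) : ∫⁻ h, f h ∂(transcriptLaw κ 0) = f PUnit.unit :=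
  lintegral_dirac (α := PUnit) PUnit.unit f

lemma lintegral_transcriptLaw_succ (κ : ∀ i, Kernel (History Y i) (Y i))
    [∀ i, IsMarkovKernel (κ i)] (n : ℕ) {f : History Y (n + 1) → ℝ≥0∞} (hf : Measurable f) :
    ∫⁻ h, f h ∂(transcriptLaw κ (n + 1)) =
      ∫⁻ h, ∫⁻ y, f (h.snoc y) ∂(κ n h) ∂(transcriptLaw κ n) :=
  Measure.lintegral_compProd (f := fun z : History Y n × Y n => f (History.snoc z.1 z.2)) hf

lemma measurable_lintegral_snoc (κ : ∀ i, Kernel (History Y i) (Y i))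
    [∀ i, IsMarkovKernel (κ i)] (n : ℕ) {f : History Y (n + 1) → ℝ≥0∞} (hf : Measurable f) :
    Measurable fun h => ∫⁻ y, f (h.snoc y) ∂(κ n h) :=
  Measurable.lintegral_kernel_prod_right' (κ := κ n)
    (f := fun z : History Y n × Y n => f (History.snoc z.1 z.2)) hf

end Transcript

section CompositionClosure

variable {𝓛 : Set (Measure EReal)}

lemma compose_mem_compositionClosure (h𝓛 : ∀ L ∈ 𝓛, IsLossLaw L) {l : List (Measure EReal)}
    (hl : ∀ L ∈ l, L ∈ insert idPLD 𝓛) : compose l ∈ compositionClosure 𝓛 := by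
  induction l using List.reverseRecOn with
  | nil => exact ⟨[], by simp, rfl⟩
  | append_singleton l L ih =>
    obtain ⟨m, hm, hml⟩ := ih fun K hK => hl K (by simp [hK])
    rw [compose_concat, ← hml]
    rcases hl L (by simp) with rfl | hL
    · have := (isLossLaw_compose fun K hK => h𝓛 K (hm K hK)).prob
      exact ⟨m, hm, by rw [conv_idPLD]⟩
    · refine ⟨m ++ [L], ?_, compose_concat m L⟩
      intro K hK
      rcases List.mem_append.1 hK with h | h
      · exact hm K h
      · rw [List.mem_singleton.1 h]; exact hL

lemma isLossLaw_of_mem_insert (h𝓛 : ∀ L ∈ 𝓛, IsLossLaw L) {L : Measure EReal}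
    (hL : L ∈ insert idPLD 𝓛) : IsLossLaw L := by
  rcases hL with rfl | hL
  exacts [isLossLaw_idPLD, h𝓛 L hL]

lemma isLossLaw_of_mem_compositionClosure (h𝓛 : ∀ L ∈ 𝓛, IsLossLaw L) {L : Measure EReal}
    (hL : L ∈ compositionClosure 𝓛) : IsLossLaw L := by
  obtain ⟨l, hl, rfl⟩ := hL
  exact isLossLaw_compose fun K hK => h𝓛 K (hl K hK)

lemma conv_mem_compositionClosure (h𝓛 : ∀ L ∈ 𝓛, IsLossLaw L) {L L' : Measure EReal}
    (hL : L ∈ compositionClosure 𝓛) (hL' : L' ∈ compositionClosure 𝓛) :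
    L.conv L' ∈ compositionClosure 𝓛 := by
  obtain ⟨l, hl, rfl⟩ := hL
  obtain ⟨l', hl', rfl⟩ := hL'
  refine ⟨l ++ l', fun K hK => ?_, ?_⟩
  · rcases List.mem_append.1 hK with h | h
    exacts [hl K h, hl' K h]
  · exact compose_append (fun K hK => h𝓛 K (hl K hK)) fun K hK => h𝓛 K (hl' K hK)

end CompositionClosure

namespace AdaptiveMechanism

variable {M : AdaptiveMechanism.{u}} {𝓛 : Set (Measure EReal)} {B : Measure EReal} {k : ℕ}

/-- The lists of PLDs that may be played in the `n` rounds after the transcript `h`. -/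
def tails (M : AdaptiveMechanism.{u}) :
    ∀ _n i : ℕ, History M.Y i → Set (List (Measure EReal))
  | 0, _, _ => {[]}
  | n + 1, i, h => {l | ∃ y : M.Y i, ∃ l' ∈ M.tails n (i + 1) (h.snoc y), l = M.roundPLD i h :: l'}

lemma mem_insert_of_mem_tails (hM : M.IsAdversary (filterRule 𝓛 B) k) {n i : ℕ} (hk : i + n ≤ k)
    {h : History M.Y i} {l : List (Measure EReal)} (hl : l ∈ M.tails n i h) :
    ∀ L ∈ l, L ∈ insert idPLD 𝓛 := by
  induction n generalizing i l with
  | zero =>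
    have : l = [] := hl
    simp [this]
  | succ n ih =>
    obtain ⟨y, l', hl', rfl⟩ := hl
    intro L hL
    rcases List.mem_cons.1 hL with rfl | hL
    · exact (hM i (by omega) h).1
    · exact ih (by omega) hl' L hL

/-- The check made by the filter in the last round concerns the whole list; `hk0` ensures that there
is a last round. -/
lemma compose_pldLE_of_mem_tails (hk0 : 0 < k) (hM : M.IsAdversary (filterRule 𝓛 B) k)
    {n i : ℕ} (hk : i + n = k) {h : History M.Y i} {l : List (Measure EReal)}
    (hl : l ∈ M.tails n i h) : PLDLE (compose (M.pastPLDs i h ++ l)) B := by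
  induction n generalizing i l with
  | zero =>
    have : l = [] := hl
    subst this
    obtain ⟨j, rfl⟩ : ∃ j, i = j + 1 := ⟨i - 1, by omega⟩
    rw [List.append_nil]
    exact (hM j (by omega) h.1).2
  | succ n ih =>
    obtain ⟨y, l', hl', rfl⟩ := hl
    have := ih (by omega) hl'
    rwa [show M.pastPLDs (i + 1) (h.snoc y) = M.pastPLDs i h ++ [M.roundPLD i h] from rfl,
      List.append_assoc, List.singleton_append] at this

lemma isLossLaw_roundPLD (M : AdaptiveMechanism.{u}) (i : ℕ) (h : History M.Y i) :
    IsLossLaw (M.roundPLD i h) :=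
  isLossLaw_pld _ _

lemma isLossLaw_totalPLD (M : AdaptiveMechanism.{u}) (k : ℕ) : IsLossLaw (M.totalPLD k) :=
  isLossLaw_pld _ _

/-- The Bayes risk of an adversary against the natural filter is controlled by the budget, given
bounds on the continuation values after `i` rounds. -/
lemma lintegral_transcriptLaw_le (h𝓛 : ∀ L ∈ 𝓛, IsLossLaw L)
    (hord : ∀ L₁ ∈ compositionClosure 𝓛, ∀ L₂ ∈ compositionClosure 𝓛,
      PLDLE L₁ L₂ ∨ PLDLE L₂ L₁) (hk0 : 0 < k)
    (hM : M.IsAdversary (filterRule 𝓛 B) k) (i n : ℕ) (hk : i + n = k)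
    {u v : History M.Y i → ℝ≥0∞} (hu : Measurable u) (hv : Measurable v)
    (huv : ∀ h, ∀ γ : ℝ≥0∞, γ ≠ ∞ →
      u h ≤ γ * v h + ⨆ l ∈ M.tails n i h, hockeyStick (compose l) γ)
    {γ : ℝ≥0∞} (hγ : γ ≠ ∞) :
    ∫⁻ h, u h ∂(transcriptLaw M.kerP i) ≤
      γ * ∫⁻ h, v h ∂(transcriptLaw M.kerQ i) + hockeyStick B γ := by
  induction i generalizing n with
  | zero =>
    rw [lintegral_transcriptLaw_zero, lintegral_transcriptLaw_zero]
    refine (huv PUnit.unit γ hγ).trans ?_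
    gcongr
    refine iSup₂_le fun l hl => hockeyStick_le_of_pldLE ?_ hγ
    exact compose_pldLE_of_mem_tails hk0 hM hk hl
  | succ i ih =>
    rw [lintegral_transcriptLaw_succ _ _ hu, lintegral_transcriptLaw_succ _ _ hv]
    refine ih (n + 1) (by omega) (measurable_lintegral_snoc _ _ hu)
      (measurable_lintegral_snoc _ _ hv) fun h γ hγ => ?_
    -- Continuations are collected over all outputs `y`, so that the bound on the value no longer
    -- depends on `y`, as the one-round lemma requires.
    set C : Set (Measure EReal) := compose '' ⋃ y, M.tails n (i + 1) (h.snoc y) with hC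
    have hCmem : ∀ L ∈ C, L ∈ compositionClosure 𝓛 := by
      rintro _ ⟨l, hl, rfl⟩
      obtain ⟨y, hy⟩ := Set.mem_iUnion.1 hl
      exact compose_mem_compositionClosure h𝓛 (mem_insert_of_mem_tails hM hk.le hy)
    have hCL : ∀ L ∈ C, IsLossLaw L := fun L hL =>
      isLossLaw_of_mem_compositionClosure h𝓛 (hCmem L hL)
    have step := lintegral_le_of_pointwise (M.kerP i h) (M.kerQ i h)
      (u := fun y => u (h.snoc y)) (v := fun y => v (h.snoc y))
      (hv.comp (History.measurable_snoc.comp measurable_prodMk_left))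
      (measurable_iSup_hockeyStick C) (fun y γ hγ => (huv (h.snoc y) γ hγ).trans (by
        gcongr
        exact iSup₂_le fun l hl => le_iSup₂_of_le
          (f := fun L (_ : L ∈ C) => hockeyStick L γ) (compose l)
          ⟨l, Set.mem_iUnion_of_mem y hl, rfl⟩ le_rfl)) hγ
    refine step.trans ?_
    gcongr
    -- Total order is used here: `C` is a chain, so choosing the continuation after seeing `y` gives
    -- no more than the best continuation fixed beforehand.
    refine (lintegral_iSup_hockeyStick hCL (fun L hL L' hL' => ?_)
      (M.isLossLaw_roundPLD i h) hγ).trans (iSup₂_le ?_)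
    · rcases hord L (hCmem L hL) L' (hCmem L' hL') with h | h
      · exact Or.inl fun γ hγ => hockeyStick_le_of_pldLE h hγ
      · exact Or.inr fun γ hγ => hockeyStick_le_of_pldLE h hγ
    · rintro _ ⟨l, hl, rfl⟩
      obtain ⟨y, hy⟩ := Set.mem_iUnion.1 hl
      have hl' : ∀ K ∈ l, IsLossLaw K := fun K hK =>
        isLossLaw_of_mem_insert h𝓛 (mem_insert_of_mem_tails hM hk.le hy K hK)
      refine le_iSup₂_of_le (f := fun l (_ : l ∈ M.tails (n + 1) i h) => hockeyStick (compose l) γ)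
        (M.roundPLD i h :: l) ⟨y, l, hy, rfl⟩ ?_
      rw [compose_cons (M.isLossLaw_roundPLD i h) hl']

end AdaptiveMechanism

/-- The natural filter is free if the composition closure of the queries is totally ordered. -/
theorem freeNaturalFilter_of_total {𝓛 : Set (Measure EReal)} (h𝓛 : ∀ L ∈ 𝓛, IsLossLaw L)
    (hord : ∀ L₁ ∈ compositionClosure 𝓛, ∀ L₂ ∈ compositionClosure 𝓛,
      PLDLE L₁ L₂ ∨ PLDLE L₂ L₁) {B : Measure EReal} (hB : IsLossLaw B) {k : ℕ} (hk : 0 < k) :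
    FreeNaturalFilter.{u} 𝓛 B k := by
  intro M hM
  refine (M.isLossLaw_totalPLD k).pldLE_of_hockeyStick_le hB fun γ hγ => ?_
  obtain ⟨f, hf, hf1, heq⟩ :=
    exists_test_eq_hockeyStick (transcriptLaw M.kerP k) (transcriptLaw M.kerQ k) γ
  have key := AdaptiveMechanism.lintegral_transcriptLaw_le h𝓛 hord hk hM k 0 rfl hf hf
    (fun h γ _ => by
      have : hockeyStick (compose []) γ = 1 - γ := hockeyStick_idPLD γ
      simp only [AdaptiveMechanism.tails, Set.mem_singleton_iff, iSup_iSup_eq_left, this]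
      exact le_mul_add_one_sub (hf1 h) γ) hγ
  rw [heq] at key
  refine (ENNReal.add_le_add_iff_left (ENNReal.mul_ne_top hγ ?_)).1 key
  exact ((lintegral_mono hf1).trans_lt (by simp)).ne

/-! ### Profiles as real functions: Lipschitz, convex, integral formula -/

open Filter Topology

/-- The hockey-stick profile as a real function. -/
noncomputable def profile (L : Measure EReal) (x : ℝ) : ℝ :=
  (hockeyStick L (ENNReal.ofReal x)).toReal

lemma measurable_kink (x : ℝ) : Measurable fun l => max (1 - x * (lossRatio l).toReal) 0 := by
  have := measurable_lossRatio.ennreal_toReal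
  fun_prop

namespace IsLossLaw

variable {L L' : Measure EReal}

lemma ofReal_profile (hL : IsLossLaw L) (x : ℝ) :
    ENNReal.ofReal (profile L x) = hockeyStick L (ENNReal.ofReal x) :=
  ENNReal.ofReal_toReal (hL.hockeyStick_ne_top _)

lemma hockeyStick_eq_ofReal_profile (hL : IsLossLaw L) {γ : ℝ≥0∞} (hγ : γ ≠ ∞) :
    hockeyStick L γ = ENNReal.ofReal (profile L γ.toReal) := by
  rw [hL.ofReal_profile, ENNReal.ofReal_toReal hγ]

lemma profile_nonneg (_ : IsLossLaw L) (x : ℝ) : 0 ≤ profile L x := ENNReal.toReal_nonneg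

lemma profile_le_one (hL : IsLossLaw L) (x : ℝ) : profile L x ≤ 1 :=
  ENNReal.toReal_le_of_le_ofReal zero_le_one (by simpa using hL.hockeyStick_le_one _)

lemma profile_le_add_abs (hL : IsLossLaw L) (x y : ℝ) :
    profile L x ≤ profile L y + |x - y| := by
  have h := hL.hockeyStick_le_add (ENNReal.ofReal x) (ENNReal.ofReal y)
  rw [← hL.ofReal_profile, ← hL.ofReal_profile] at h
  have h2 : ENNReal.ofReal y - ENNReal.ofReal x ≤ ENNReal.ofReal |x - y| := by
    rw [tsub_le_iff_right]
    refine (ENNReal.ofReal_le_ofReal ?_).trans ENNReal.ofReal_add_le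
    linarith [neg_abs_le (x - y)]
  have h3 := h.trans (add_le_add_right h2 _)
  rw [← ENNReal.ofReal_add (hL.profile_nonneg y) (abs_nonneg _)] at h3
  exact (ENNReal.ofReal_le_ofReal_iff (add_nonneg (hL.profile_nonneg y) (abs_nonneg _))).1 h3

lemma one_sub_le_profile (hL : IsLossLaw L) {x : ℝ} (hx : 0 ≤ x) : 1 - x ≤ profile L x := by
  have h := hL.one_sub_le_hockeyStick (ENNReal.ofReal x)
  rw [← hL.ofReal_profile, ← ENNReal.ofReal_one, ← ENNReal.ofReal_sub _ hx] at h
  exact (ENNReal.ofReal_le_ofReal_iff (hL.profile_nonneg x)).1 h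

lemma continuous_profile (hL : IsLossLaw L) : Continuous (profile L) :=
  (LipschitzWith.of_le_add fun x y => by
    rw [Real.dist_eq]; exact hL.profile_le_add_abs x y).continuous

lemma continuousAt_hockeyStick (hL : IsLossLaw L) {γ : ℝ≥0∞} (hγ : γ ≠ ∞) :
    ContinuousAt (hockeyStick L) γ := by
  have h1 : ContinuousAt (fun γ : ℝ≥0∞ => ENNReal.ofReal (profile L γ.toReal)) γ :=
    ENNReal.continuous_ofReal.continuousAt.comp
      (hL.continuous_profile.continuousAt.comp (ENNReal.tendsto_toReal hγ))
  refine h1.congr ?_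
  filter_upwards [isOpen_ne.mem_nhds hγ] with x hx
  exact (hL.hockeyStick_eq_ofReal_profile hx).symm

lemma hockeyStick_le_iff_profile_le (hL : IsLossLaw L) (hL' : IsLossLaw L') (x : ℝ) :
    hockeyStick L (ENNReal.ofReal x) ≤ hockeyStick L' (ENNReal.ofReal x) ↔
      profile L x ≤ profile L' x :=
  (ENNReal.toReal_le_toReal (hL.hockeyStick_ne_top _) (hL'.hockeyStick_ne_top _)).symm

lemma pldLE_iff_profile_le (hL : IsLossLaw L) (hL' : IsLossLaw L') :
    PLDLE L L' ↔ ∀ x, 0 < x → profile L x ≤ profile L' x := by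
  rw [pldLE_iff hL hL']
  constructor
  · exact fun h x _ => (hL.hockeyStick_le_iff_profile_le hL' x).1 (h _ ENNReal.ofReal_ne_top)
  · intro h γ hγ
    rcases eq_or_ne γ 0 with rfl | h0
    · rw [hL.hockeyStick_zero, hL'.hockeyStick_zero]
    · rw [← ENNReal.ofReal_toReal hγ, hL.hockeyStick_le_iff_profile_le hL']
      exact h _ (ENNReal.toReal_pos h0 hγ)

lemma profile_eq_integral (hL : IsLossLaw L) {x : ℝ} (hx : 0 ≤ x) :
    profile L x = ∫ l, max (1 - x * (lossRatio l).toReal) 0 ∂L := by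
  rw [integral_eq_lintegral_of_nonneg_ae
    (f := fun l => max (1 - x * (lossRatio l).toReal) 0) (ae_of_all _ fun l => le_max_right _ _)
    (measurable_kink x).aestronglyMeasurable, profile, hockeyStick]
  congr 1
  refine lintegral_congr_ae ?_
  filter_upwards [hL.ae_ne_bot] with l hl
  have ht : lossRatio l ≠ ∞ := by simpa [lossRatio_eq_top] using hl
  conv_lhs => rw [← ENNReal.ofReal_toReal ht]
  rw [← ENNReal.ofReal_mul hx, ← ENNReal.ofReal_one, ← ENNReal.ofReal_sub _ (by positivity)]
  rcases le_total 0 (1 - x * (lossRatio l).toReal) with h | h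
  · rw [max_eq_left h]
  · rw [max_eq_right h, ENNReal.ofReal_of_nonpos h, ENNReal.ofReal_zero]

lemma integrable_profile (hL : IsLossLaw L) {x : ℝ} (hx : 0 ≤ x) :
    Integrable (fun l => max (1 - x * (lossRatio l).toReal) 0) L := by
  have := hL.prob
  refine Integrable.of_bound (measurable_kink x).aestronglyMeasurable 1 (ae_of_all _ fun l => ?_)
  rw [Real.norm_of_nonneg (le_max_right _ _)]
  refine max_le ?_ zero_le_one
  have : 0 ≤ x * (lossRatio l).toReal := by positivity
  linarith

lemma profile_convexOn (hL : IsLossLaw L) : ConvexOn ℝ (Set.Ici 0) (profile L) := by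
  refine ⟨convex_Ici 0, fun x hx y hy α β hα hβ hαβ => ?_⟩
  have hx : 0 ≤ x := hx
  have hy : 0 ≤ y := hy
  simp only [smul_eq_mul]
  rw [hL.profile_eq_integral hx, hL.profile_eq_integral hy,
    hL.profile_eq_integral (by positivity), ← integral_const_mul, ← integral_const_mul,
    ← integral_add ((hL.integrable_profile hx).const_mul _)
      ((hL.integrable_profile hy).const_mul _)]
  refine integral_mono (hL.integrable_profile (by positivity))
    (((hL.integrable_profile hx).const_mul _).add ((hL.integrable_profile hy).const_mul _))
    fun l => ?_
  have h1 := le_max_left (1 - x * (lossRatio l).toReal) 0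
  have h2 := le_max_left (1 - y * (lossRatio l).toReal) 0
  have h3 := mul_nonneg hα (le_max_right (1 - x * (lossRatio l).toReal) 0)
  have h4 := mul_nonneg hβ (le_max_right (1 - y * (lossRatio l).toReal) 0)
  refine max_le ?_ (by simp only; linarith)
  have h5 := mul_le_mul_of_nonneg_left h1 hα
  have h6 := mul_le_mul_of_nonneg_left h2 hβ
  have : 1 - (α * x + β * y) * (lossRatio l).toReal =
      α * (1 - x * (lossRatio l).toReal) + β * (1 - y * (lossRatio l).toReal) := by
    linear_combination (-1) * hαβ
  simp only
  linarith

end IsLossLaw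

/-! ### An extremal budget, and mechanisms with a single branching -/

/-- Among the budgets with a given hockey-stick divergence `g` at `γ` there is a largest one. -/
lemma exists_isLossLaw_hockeyStick_eq {γ g : ℝ≥0∞} (h0 : γ ≠ 0) (ht : γ ≠ ∞) (hg1 : g ≤ 1)
    (hg : 1 - γ ≤ g) : ∃ B, IsLossLaw B ∧ hockeyStick B γ = g ∧
      ∀ L, IsLossLaw L → hockeyStick L γ ≤ g → ∀ x, hockeyStick L x ≤ hockeyStick B x := by
  have hlog : lossRatio (ENNReal.log γ) = γ⁻¹ := by simp [lossRatio]
  have hm := measurable_lossRatio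
  set B := g • Measure.dirac (⊤ : EReal) + (1 - g) • Measure.dirac (ENNReal.log γ) with hBdef
  -- This profile is the chord from `(0, 1)` to `(γ, g)`, constant afterwards. Convexity bounds any
  -- competitor by the chord, monotonicity by the constant. The condition `1 - γ ≤ g` gives the
  -- ratio integral `(1 - g) / γ ≤ 1`.
  have hB : ∀ x, hockeyStick B x = g + (1 - g) * (1 - x / γ) := by
    intro x
    rw [hockeyStick, hBdef, lintegral_add_measure, lintegral_smul_measure, lintegral_smul_measure,
      lintegral_dirac, lintegral_dirac, hlog]
    simp [div_eq_mul_inv]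
  have hBγ : hockeyStick B γ = g := by rw [hB, ENNReal.div_self h0 ht]; simp
  refine ⟨B, ⟨⟨?_⟩, ?_, ?_⟩, hBγ, fun L hL hLg x => ?_⟩
  · simp [hBdef, add_tsub_cancel_of_le hg1]
  · simp [hBdef, ENNReal.log_eq_bot_iff, h0]
  · rw [hBdef, lintegral_add_measure, lintegral_smul_measure, lintegral_smul_measure,
      lintegral_dirac, lintegral_dirac, hlog]
    simp only [lossRatio_top, smul_eq_mul, mul_zero, zero_add]
    rw [← div_eq_mul_inv]
    refine ENNReal.div_le_of_le_mul ?_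
    rw [one_mul, tsub_le_iff_right]
    exact tsub_le_iff_left.1 hg
  · rcases le_total γ x with h | h
    · calc hockeyStick L x ≤ hockeyStick L γ := antitone_hockeyStick L h
        _ ≤ g := hLg
        _ ≤ hockeyStick B x := by rw [hB]; exact le_self_add
    · have := hL.prob
      set θ := x / γ with hθ
      have hθ1 : θ ≤ 1 := ENNReal.div_le_of_le_mul (by simpa using h)
      have hx : x = θ * γ := (ENNReal.div_mul_cancel h0 ht).symm
      have hpt : ∀ r : ℝ≥0∞, 1 - x * r ≤ (1 - θ) + θ * (1 - γ * r) := by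
        intro r
        rw [tsub_le_iff_right, hx]
        calc 1 = (1 - θ) + θ * 1 := by rw [mul_one, tsub_add_cancel_of_le hθ1]
          _ ≤ (1 - θ) + θ * ((1 - γ * r) + γ * r) := by gcongr; exact le_tsub_add
          _ = _ := by ring
      calc hockeyStick L x ≤ ∫⁻ l, ((1 - θ) + θ * (1 - γ * lossRatio l)) ∂L :=
            lintegral_mono fun l => hpt _
        _ = (1 - θ) + θ * hockeyStick L γ := by
            rw [lintegral_add_left measurable_const, lintegral_const_mul _ (by fun_prop)]
            simp [hockeyStick]
        _ ≤ (1 - θ) + θ * g := by gcongr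
        _ = hockeyStick B x := by
            rw [hB]
            calc (1 - θ) + θ * g = (g + (1 - g)) * (1 - θ) + θ * g := by
                  rw [add_tsub_cancel_of_le hg1, one_mul]
              _ = g * ((1 - θ) + θ) + (1 - g) * (1 - θ) := by ring
              _ = _ := by rw [tsub_add_cancel_of_le hθ1, mul_one]

section Branching

/-- The total privacy loss of a transcript of canonical mechanisms. -/
noncomputable def totalLoss : ∀ n, History (fun _ => ULift.{u} EReal) n → EReal
  | 0, _ => 0
  | n + 1, h => totalLoss n h.1 + h.2.down

/-- The branch taken after a transcript: it is decided by the total loss of the first `m` rounds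
and kept from then on. -/
noncomputable def branch (m : ℕ) (A : EReal → Bool) :
    ∀ n, History (fun _ => ULift.{u} EReal) n → Bool
  | 0, _ => A 0
  | n + 1, h => if n < m then A (totalLoss (n + 1) h) else branch m A n h.1

lemma totalLoss_snoc (n : ℕ) (h : History (fun _ => ULift.{u} EReal) n) (y : ULift.{u} EReal) :
    totalLoss (n + 1) (h.snoc y) = totalLoss n h + y.down := rfl

lemma branch_snoc {m n : ℕ} (hmn : m ≤ n) (A : EReal → Bool)
    (h : History (fun _ => ULift.{u} EReal) n) (y : ULift.{u} EReal) :
    branch m A (n + 1) (h.snoc y) = branch m A n h :=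
  if_neg (not_lt.2 hmn)

lemma branch_self (m : ℕ) (A : EReal → Bool) (h : History (fun _ => ULift.{u} EReal) m) :
    branch m A m h = A (totalLoss m h) := by
  cases m with
  | zero => rfl
  | succ m => exact if_pos (Nat.lt_succ_self m)

lemma measurable_totalLoss : ∀ n, Measurable (totalLoss.{u} n)
  | 0 => measurable_const
  | n + 1 => by
    have h1 : Measurable fun z : History (fun _ => ULift.{u} EReal) n × ULift.{u} EReal =>
        totalLoss n z.1 + z.2.down :=
      ((measurable_totalLoss n).comp measurable_fst).add (measurable_down.comp measurable_snd)
    exact h1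

lemma measurable_branch (m : ℕ) {A : EReal → Bool} (hA : Measurable A) :
    ∀ n, Measurable (branch.{u} m A n)
  | 0 => measurable_const
  | n + 1 => by
    by_cases h : n < m
    · have : branch.{u} m A (n + 1) = fun z => A (totalLoss (n + 1) z) := by
        funext z; exact if_pos h
      rw [this]
      exact hA.comp (measurable_totalLoss (n + 1))
    · have h1 : Measurable fun z : History (fun _ => ULift.{u} EReal) n × ULift.{u} EReal =>
          branch m A n z.1 := (measurable_branch m hA n).comp measurable_fst
      have : branch.{u} m A (n + 1) = fun z => branch m A n z.1 := by
        funext z; exact if_neg h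
      rw [this]
      exact h1

/-- The measurable equivalence of `EReal` with its lift to another universe. -/
noncomputable def liftEReal : EReal ≃ᵐ ULift.{u} EReal := MeasurableEquiv.ulift.symm

/-- The kernel that plays `c b i` in round `i` on branch `b`. -/
noncomputable def branchKernel (m : ℕ) {A : EReal → Bool} (hA : Measurable A)
    (c : Bool → ℕ → Measure EReal) (i : ℕ) :
    Kernel (History (fun _ => ULift.{u} EReal) i) (ULift.{u} EReal) :=
  (Kernel.ofFunOfCountable fun b => (c b i).map liftEReal).comap (branch m A i)
    (measurable_branch m hA i)

lemma branchKernel_apply (m : ℕ) {A : EReal → Bool} (hA : Measurable A)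
    (c : Bool → ℕ → Measure EReal) (i : ℕ) (h : History (fun _ => ULift.{u} EReal) i) :
    branchKernel m hA c i h = (c (branch m A i h) i).map liftEReal := rfl

instance isMarkovKernel_branchKernel (m : ℕ) {A : EReal → Bool} (hA : Measurable A)
    (c : Bool → ℕ → Measure EReal) (i : ℕ) [hc : ∀ b i, IsProbabilityMeasure (c b i)] :
    IsMarkovKernel (branchKernel.{u} m hA c i) :=
  ⟨fun _ => Measure.isProbabilityMeasure_map liftEReal.measurable.aemeasurable⟩

lemma lintegral_branchKernel (m : ℕ) {A : EReal → Bool} (hA : Measurable A)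
    (c : Bool → ℕ → Measure EReal) (i : ℕ) (h : History (fun _ => ULift.{u} EReal) i)
    (f : ULift.{u} EReal → ℝ≥0∞) :
    ∫⁻ y, f y ∂(branchKernel m hA c i h) = ∫⁻ x, f ⟨x⟩ ∂(c (branch m A i h) i) := by
  rw [branchKernel_apply, lintegral_map_equiv]; rfl

/-- An adaptive mechanism with a single branching: it plays the sequence `c true` or `c false`,
according to the total loss of the first `m` rounds. -/
noncomputable def branchMechanism (m : ℕ) {A : EReal → Bool} (hA : Measurable A)
    (c : Bool → ℕ → Measure EReal) (hc : ∀ b i, IsLossLaw (c b i)) : AdaptiveMechanism.{u} :=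
  have := fun b i => (hc b i).prob
  have := fun b i => (hc b i).isProbabilityMeasure_dualLaw
  { Y := fun _ => ULift.{u} EReal
    kerP := branchKernel m hA c
    kerQ := branchKernel m hA fun b i => dualLaw (c b i) }

variable (m : ℕ) {A : EReal → Bool} (hA : Measurable A) {c : Bool → ℕ → Measure EReal}
  (hc : ∀ b i, IsLossLaw (c b i))

lemma roundPLD_branchMechanism (i : ℕ) (h : History (fun _ => ULift.{u} EReal) i) :
    (branchMechanism m hA c hc).roundPLD i h = c (branch m A i h) i := by
  have := (hc (branch m A i h) i).prob
  have := (hc (branch m A i h) i).isProbabilityMeasure_dualLaw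
  exact (pld_map _ _ liftEReal).trans (hc _ i).pld_dualLaw

lemma map_range_eq_of_le (hcm : ∀ b b', ∀ i < m, c b i = c b' i) {n : ℕ} (hn : n ≤ m)
    (b b' : Bool) : (List.range n).map (c b) = (List.range n).map (c b') :=
  List.map_congr_left fun i hi => hcm b b' i ((List.mem_range.1 hi).trans_le hn)

lemma pastPLDs_branchMechanism (hcm : ∀ b b', ∀ i < m, c b i = c b' i) (n : ℕ)
    (h : History (fun _ => ULift.{u} EReal) n) :
    (branchMechanism m hA c hc).pastPLDs n h = (List.range n).map (c (branch m A n h)) := by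
  induction n with
  | zero => rfl
  | succ n ih =>
    have : (branchMechanism m hA c hc).pastPLDs (n + 1) h =
      (branchMechanism m hA c hc).pastPLDs n h.1 ++
        [(branchMechanism m hA c hc).roundPLD n h.1] := rfl
    rw [this, ih h.1, roundPLD_branchMechanism, ← List.map_singleton, ← List.map_append,
      ← List.range_succ]
    by_cases hn : n < m
    · exact map_range_eq_of_le m hcm hn _ _
    · have : branch m A (n + 1) h = branch m A n h.1 := if_neg hn
      rw [this]

lemma hockeyStick_compose_range_mono (hc : ∀ b i, IsLossLaw (c b i)) (b : Bool) (γ : ℝ≥0∞) :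
    Monotone fun n => hockeyStick (compose ((List.range n).map (c b))) γ := by
  refine monotone_nat_of_le_succ fun n => ?_
  rw [List.range_succ, List.map_append, List.map_singleton, compose_concat]
  exact (isLossLaw_compose (by simp; exact fun i _ => hc b i)).hockeyStick_le_conv (hc b n) γ

/-- Profiles only grow as rounds are added, so it suffices that each of the two full sequences
respects the budget. The common first `m` rounds make the past a prefix of one of these sequences.
-/
lemma isAdversary_branchMechanism {𝓛 : Set (Measure EReal)} {B : Measure EReal} {k : ℕ}
    (hc : ∀ b i, IsLossLaw (c b i)) (hcm : ∀ b b', ∀ i < m, c b i = c b' i)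
    (hmem : ∀ b i, c b i ∈ insert idPLD 𝓛) (hB : IsLossLaw B)
    (hle : ∀ b x, hockeyStick (compose ((List.range k).map (c b))) x ≤ hockeyStick B x) :
    (branchMechanism.{u} m hA c hc).IsAdversary (filterRule 𝓛 B) k := by
  intro i hi h
  have e1 := roundPLD_branchMechanism m hA hc i h
  have e2 := pastPLDs_branchMechanism m hA hc hcm i h
  refine ⟨by rw [e1]; exact hmem _ _, ?_⟩
  rw [e1, e2, ← List.map_singleton, ← List.map_append, ← List.range_succ]
  refine (isLossLaw_compose (by simp; exact fun i _ => hc _ i)).pldLE_of_hockeyStick_le hB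
    fun x _ => ?_
  exact (hockeyStick_compose_range_mono hc _ x (show i + 1 ≤ k from hi)).trans (hle _ x)

/-- The second transcript law has density `exp (- totalLoss)` with respect to the first one where
the loss is not `⊥`. -/
lemma lintegral_transcriptLaw_dual (hc : ∀ b i, IsLossLaw (c b i)) (n : ℕ) {f : History (fun _ => ULift.{u} EReal) n → ℝ≥0∞}
    (hf : Measurable f) (h0 : ∀ h, totalLoss n h = ⊥ → f h = 0) :
    ∫⁻ h, f h ∂(transcriptLaw (branchKernel m hA fun b i => dualLaw (c b i)) n) =
      ∫⁻ h, f h * lossRatio (totalLoss n h) ∂(transcriptLaw (branchKernel m hA c) n) := by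
  have hr := measurable_lossRatio
  have := fun b i => (hc b i).prob
  have := fun b i => (hc b i).isProbabilityMeasure_dualLaw
  induction n with
  | zero =>
    refine (lintegral_transcriptLaw_zero _ _).trans (Eq.trans ?_
      (lintegral_transcriptLaw_zero _ _).symm)
    simp [totalLoss]
  | succ n ih =>
    have hfr : Measurable fun h => f h * lossRatio (totalLoss (n + 1) h) :=
      hf.mul (hr.comp (measurable_totalLoss (n + 1)))
    refine (lintegral_transcriptLaw_succ (branchKernel m hA fun b i => dualLaw (c b i)) n hf).trans (Eq.trans ?_
      (lintegral_transcriptLaw_succ (branchKernel.{u} m hA c) n hfr).symm)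
    rw [ih (measurable_lintegral_snoc (branchKernel m hA fun b i => dualLaw (c b i)) n hf)]
    · refine lintegral_congr fun h => ?_
      have hfh : Measurable fun x : EReal => f (h.snoc ⟨x⟩) :=
        hf.comp (History.measurable_snoc.comp
          (measurable_const.prodMk measurable_up))
      have e1 : ∫⁻ y, f (h.snoc y) ∂((branchKernel m hA fun b i => dualLaw (c b i)) n h) =
          ∫⁻ x, f (h.snoc ⟨x⟩) ∂(dualLaw (c (branch m A n h) n)) :=
        lintegral_branchKernel m hA (fun b i => dualLaw (c b i)) n h _
      have e2 : ∫⁻ y, f (h.snoc y) * lossRatio (totalLoss (n + 1) (h.snoc y)) ∂((branchKernel.{u} m hA c) n h) =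
          ∫⁻ x, f (h.snoc ⟨x⟩) * lossRatio (totalLoss (n + 1) (h.snoc ⟨x⟩))
            ∂(c (branch m A n h) n) :=
        lintegral_branchKernel m hA c n h _
      -- In `EReal` a summand `⊥` makes the whole sum `⊥`, so `f` vanishes on the atom of the dual
      -- law.
      rw [e1, e2, lintegral_dualLaw _ hfh (h0 _ (by
          rw [totalLoss_snoc]; simp)),
        ← lintegral_mul_const (f := fun x => f (h.snoc ⟨x⟩) * lossRatio x) _ (hfh.mul hr)]
      refine lintegral_congr fun x => ?_
      rw [totalLoss_snoc]
      by_cases hx : x = ⊥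
      · rw [h0 _ (by simp [totalLoss_snoc, hx])]; simp
      by_cases hh : totalLoss n h = ⊥
      · rw [h0 _ (by simp [totalLoss_snoc, hh])]; simp
      rw [lossRatio_add hh hx]; ring
    · intro h hh
      refine (lintegral_congr fun y => h0 _ ?_).trans lintegral_zero
      simp [totalLoss_snoc, hh]

/-- The first transcript law: before the branching the loss is distributed as the convolution of
the laws played. -/
lemma lintegral_totalLoss_of_le (hc : ∀ b i, IsLossLaw (c b i)) (hcm : ∀ b b', ∀ i < m, c b i = c b' i) (b : Bool) {n : ℕ}
    (hn : n ≤ m) {F : EReal → ℝ≥0∞} (hF : Measurable F) :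
    ∫⁻ h, F (totalLoss n h) ∂(transcriptLaw (branchKernel.{u} m hA c) n) =
      ∫⁻ x, F x ∂(compose ((List.range n).map (c b))) := by
  have := fun b i => (hc b i).prob
  induction n generalizing F with
  | zero =>
    refine (lintegral_transcriptLaw_zero _ _).trans ?_
    simp [totalLoss, idPLD]
  | succ n ih =>
    refine (lintegral_transcriptLaw_succ (branchKernel.{u} m hA c) n (hF.comp (measurable_totalLoss (n + 1)))).trans ?_
    rw [List.range_succ, List.map_append, List.map_singleton, compose_concat,
      Measure.lintegral_conv hF, ← ih (by omega) (F := fun x => ∫⁻ y, F (x + y) ∂(c b n))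
        (by fun_prop)]
    refine lintegral_congr fun h => ?_
    refine (lintegral_branchKernel m hA c n h _).trans ?_
    rw [hcm (branch m A n h) b n (by omega)]
    rfl

/-- After the branching the laws of the branch are convolved. -/
lemma lintegral_totalLoss_add (hc : ∀ b i, IsLossLaw (c b i)) (hcm : ∀ b b', ∀ i < m, c b i = c b' i) (b : Bool) (j : ℕ)
    {F : EReal → ℝ≥0∞} (hF : Measurable F) :
    ∫⁻ h, (if branch m A (m + j) h = b then F (totalLoss (m + j) h) else 0)
        ∂(transcriptLaw (branchKernel.{u} m hA c) (m + j)) =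
      ∫⁻ x, (if A x = b then
        ∫⁻ z, F (x + z) ∂(compose ((List.range j).map fun i => c b (m + i))) else 0)
        ∂(compose ((List.range m).map (c b))) := by
  have hl : ∀ j, IsLossLaw (compose ((List.range j).map fun i => c b (m + i))) := fun j =>
    isLossLaw_compose (by simp; exact fun i _ => hc b _)
  have := fun b i => (hc b i).prob
  induction j generalizing F with
  | zero =>
    simp only [List.range_zero, List.map_nil, compose_nil, idPLD, lintegral_dirac, add_zero]
    refine (lintegral_congr fun h => by
      rw [show branch m A (m + 0) h = A (totalLoss m h) from branch_self m A h]).trans ?_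
    exact lintegral_totalLoss_of_le m hA hc hcm b le_rfl
      (F := fun x => if A x = b then F x else 0)
      (Measurable.ite (hA (measurableSet_singleton b)) hF measurable_const)
  | succ j ih =>
    have := (hl j).prob
    have hm : Measurable fun h : History (fun _ => ULift.{u} EReal) (m + j + 1) =>
        if branch m A (m + j + 1) h = b then F (totalLoss (m + j + 1) h) else 0 :=
      Measurable.ite (measurable_branch m hA _ (measurableSet_singleton b))
        (hF.comp (measurable_totalLoss _)) measurable_const
    refine (lintegral_transcriptLaw_succ (branchKernel.{u} m hA c) (m + j) hm).trans ?_
    have hr : ∀ x, ∫⁻ z, F (x + z) ∂(compose ((List.range (j + 1)).map fun i => c b (m + i))) =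
        ∫⁻ z, ∫⁻ y, F (x + z + y) ∂(c b (m + j))
          ∂(compose ((List.range j).map fun i => c b (m + i))) := by
      intro x
      rw [List.range_succ, List.map_append, List.map_singleton, compose_concat,
        Measure.lintegral_conv (by fun_prop)]
      simp only [add_assoc]
    simp only [hr]
    rw [← ih (F := fun x => ∫⁻ y, F (x + y) ∂(c b (m + j))) (by fun_prop)]
    refine lintegral_congr fun h => ?_
    refine (lintegral_branchKernel m hA c (m + j) h _).trans ?_
    simp only [branch_snoc (Nat.le_add_right m j), totalLoss_snoc]
    split_ifs with hb
    · rw [hb]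
    · simp

/-- The value of the branching mechanism is at least the average, over the loss in the first `m`
rounds, of the value of the continuation chosen. -/
lemma lintegral_le_hockeyStick_totalPLD (hcm : ∀ b b', ∀ i < m, c b i = c b' i) (b₀ : Bool)
    (j : ℕ) {γ : ℝ≥0∞} (h0 : γ ≠ 0) (hγ : γ ≠ ∞) :
    ∫⁻ x, hockeyStick (compose ((List.range j).map fun i => c (A x) (m + i))) (γ * lossRatio x)
        ∂(compose ((List.range m).map (c b₀))) ≤
      hockeyStick ((branchMechanism.{u} m hA c hc).totalPLD (m + j)) γ := by
  set K := compose ((List.range m).map (c b₀)) with hKdef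
  set P := transcriptLaw (branchKernel.{u} m hA c) (m + j) with hP
  set Q := transcriptLaw (branchKernel m hA fun b i => dualLaw (c b i)) (m + j) with hQ
  have := fun b i => (hc b i).prob
  have := fun b i => (hc b i).isProbabilityMeasure_dualLaw
  have hK : IsLossLaw K := isLossLaw_compose (by simp; exact fun i _ => hc b₀ i)
  have hR : ∀ b, IsLossLaw (compose ((List.range j).map fun i => c b (m + i))) := fun b =>
    isLossLaw_compose (by simp; exact fun i _ => hc b _)
  have hr := measurable_lossRatio
  set F : EReal → ℝ≥0∞ := fun x => 1 - γ * lossRatio x with hF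
  have hFm : Measurable F := by fun_prop
  have hKb : ∀ b, compose ((List.range m).map (c b)) = K := fun b => by
    rw [hKdef, map_range_eq_of_le m hcm le_rfl b b₀]
  have hbranch : ∀ b, ∫⁻ h, (if branch m A (m + j) h = b then F (totalLoss (m + j) h) else 0) ∂P =
      ∫⁻ x, (if A x = b then hockeyStick (compose ((List.range j).map fun i => c b (m + i)))
        (γ * lossRatio x) else 0) ∂K := by
    intro b
    refine (lintegral_totalLoss_add m hA hc hcm b j hFm).trans ?_
    rw [hKb b]
    refine lintegral_congr_ae ?_
    filter_upwards [hK.ae_ne_bot] with x hx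
    congr 1
    refine lintegral_congr_ae ?_
    filter_upwards [(hR b).ae_ne_bot] with z hz
    rw [hF]; simp only
    rw [lossRatio_add hx hz, mul_assoc]
  have hval : ∫⁻ h, F (totalLoss (m + j) h) ∂P =
      ∫⁻ x, hockeyStick (compose ((List.range j).map fun i => c (A x) (m + i)))
        (γ * lossRatio x) ∂K := by
    have hsplit : ∀ (b : Bool) (G : Bool → ℝ≥0∞),
        G b = (if b = true then G true else 0) + (if b = false then G false else 0) := by
      intro b G; cases b <;> simp
    have e1 : ∀ h, F (totalLoss (m + j) h) =
        (if branch m A (m + j) h = true then F (totalLoss (m + j) h) else 0) +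
        (if branch m A (m + j) h = false then F (totalLoss (m + j) h) else 0) := fun h =>
      hsplit _ fun _ => F (totalLoss (m + j) h)
    have e2 := fun x => hsplit (A x) fun b => hockeyStick
      (compose ((List.range j).map fun i => c b (m + i))) (γ * lossRatio x)
    rw [lintegral_congr e1, lintegral_congr e2, lintegral_add_left, lintegral_add_left,
      hbranch, hbranch]
    · exact Measurable.ite (hA (measurableSet_singleton _))
        ((measurable_hockeyStick _).comp (by fun_prop)) measurable_const
    · exact Measurable.ite (measurable_branch m hA _ (measurableSet_singleton _))
        (hFm.comp (measurable_totalLoss _)) measurable_const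
  rw [← hval]
  -- The likelihood ratio test on the total loss. Only a lower bound for the profile is needed, so
  -- any test serves; `γ ≠ 0` keeps transcripts of loss `⊥` out of it.
  set T := {h : History (fun _ => ULift.{u} EReal) (m + j) |
    γ * lossRatio (totalLoss (m + j) h) ≤ 1} with hT
  have hTm : MeasurableSet T := measurableSet_le
    (measurable_const.mul (hr.comp (measurable_totalLoss _))) measurable_const
  have hf1 : Measurable (T.indicator (1 : History (fun _ => ULift.{u} EReal) (m + j) → ℝ≥0∞)) := measurable_one.indicator hTm
  have hle := lintegral_le_hockeyStick P Q hf1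
    (fun h => Set.indicator_le_self' (by simp) h) hγ
  have hQf : ∫⁻ h, T.indicator 1 h ∂Q =
      ∫⁻ h, T.indicator 1 h * lossRatio (totalLoss (m + j) h) ∂P := by
    refine lintegral_transcriptLaw_dual m hA hc (m + j) hf1 fun h hh => ?_
    refine Set.indicator_of_notMem (fun hmem => ?_) _
    have : γ * lossRatio (totalLoss (m + j) h) ≤ 1 := hmem
    rw [hh, lossRatio_bot, ENNReal.mul_top h0] at this
    simp at this
  have hPf : ∫⁻ h, T.indicator 1 h ∂P = γ * ∫⁻ h, T.indicator 1 h ∂Q +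
      ∫⁻ h, F (totalLoss (m + j) h) ∂P := by
    have hm2 : Measurable fun h => T.indicator 1 h * lossRatio (totalLoss (m + j) h) :=
      hf1.mul (hr.comp (measurable_totalLoss _))
    rw [hQf, ← lintegral_const_mul _ hm2, ← lintegral_add_left (hm2.const_mul γ)]
    refine lintegral_congr fun h => ?_
    by_cases hh : h ∈ T
    · have : γ * lossRatio (totalLoss (m + j) h) ≤ 1 := hh
      simp [Set.indicator_of_mem hh, hF, add_tsub_cancel_of_le this]
    · have : ¬ γ * lossRatio (totalLoss (m + j) h) ≤ 1 := hh
      simp [Set.indicator_of_notMem hh, hF, tsub_eq_zero_of_le (not_le.1 this).le]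
  rw [hPf] at hle
  change _ ≤ hockeyStick (pld P Q) γ
  refine (ENNReal.add_le_add_iff_left (ENNReal.mul_ne_top hγ ?_)).1 hle
  exact ((lintegral_mono fun h => Set.indicator_le_self' (by simp) h).trans_lt
    (by simp : ∫⁻ _, (1 : ℝ≥0∞) ∂Q < ∞)).ne

end Branching

/-! ### The attack: crossing profiles refute freeness -/

section Attack

variable {𝓛 : Set (Measure EReal)}

/-- Padding with the trivial query lets branches of different lengths run for a common number of
rounds. -/
lemma compose_map_range_getD {l : List (Measure EReal)} (hl : ∀ L ∈ l, IsLossLaw L) {n : ℕ}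
    (hn : l.length ≤ n) : compose ((List.range n).map fun i => l.getD i idPLD) = compose l := by
  have hgetD : ∀ i, IsLossLaw (l.getD i idPLD) := fun i => by
    rcases lt_or_ge i l.length with h | h
    · rw [List.getD_eq_getElem _ _ h]; exact hl _ (List.getElem_mem h)
    · rw [List.getD_eq_default _ _ h]; exact isLossLaw_idPLD
  induction n, hn using Nat.le_induction with
  | base =>
    congr 1
    refine List.ext_getElem (by simp) fun i h1 h2 => ?_
    simp [h2]
  | succ n hn ih =>
    have := (isLossLaw_compose hl).prob
    rw [List.range_succ, List.map_append, List.map_singleton, compose_concat, ih,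
      List.getD_eq_default _ _ hn, conv_idPLD]

/-- A free natural filter leaves no room for adaptivity: if the loss of the non-adaptive composition
`K` may take values after which different continuations are preferable, then the natural filter is
not free. -/
theorem not_crossing_of_free (h𝓛 : ∀ L ∈ 𝓛, IsLossLaw L)
    (hfree : ∀ B : Measure EReal, IsPLD B → ∀ k : ℕ, 0 < k → FreeNaturalFilter.{u} 𝓛 B k)
    {K L₁ L₂ : Measure EReal} (hK : K ∈ compositionClosure 𝓛) (h₁ : L₁ ∈ compositionClosure 𝓛)
    (h₂ : L₂ ∈ compositionClosure 𝓛) {γ : ℝ≥0∞} (h0 : γ ≠ 0) (hγ : γ ≠ ∞) {s t : ℝ}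
    (hs : (s : EReal) ∈ K.support) (ht : (t : EReal) ∈ K.support)
    (hs' : hockeyStick L₂ (γ * lossRatio s) < hockeyStick L₁ (γ * lossRatio s))
    (ht' : hockeyStick L₁ (γ * lossRatio t) < hockeyStick L₂ (γ * lossRatio t)) : False := by
  have hKl := isLossLaw_of_mem_compositionClosure h𝓛 hK
  have hLl₁ := isLossLaw_of_mem_compositionClosure h𝓛 h₁
  have hLl₂ := isLossLaw_of_mem_compositionClosure h𝓛 h₂
  have hr := measurable_lossRatio
  have hm₁ : Measurable fun x => hockeyStick L₁ (γ * lossRatio x) :=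
    (measurable_hockeyStick L₁).comp (by fun_prop)
  have hm₂ : Measurable fun x => hockeyStick L₂ (γ * lossRatio x) :=
    (measurable_hockeyStick L₂).comp (by fun_prop)
  obtain ⟨lK, hlK, rfl⟩ := hK
  obtain ⟨l₁, hl₁, rfl⟩ := h₁
  obtain ⟨l₂, hl₂, rfl⟩ := h₂
  -- After loss `x` in `K` the slope has become `γ * lossRatio x`; the branch with the larger
  -- profile there is taken.
  set A : EReal → Bool := fun x => decide (hockeyStick (compose l₂) (γ * lossRatio x) ≤
    hockeyStick (compose l₁) (γ * lossRatio x)) with hAdef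
  have hA : Measurable A := by
    refine measurable_to_bool ?_
    have : A ⁻¹' {true} = {x | hockeyStick (compose l₂) (γ * lossRatio x) ≤
        hockeyStick (compose l₁) (γ * lossRatio x)} := by
      ext x; simp [hAdef]
    rw [this]
    exact measurableSet_le hm₂ hm₁
  set lb : Bool → List (Measure EReal) := fun b => cond b l₁ l₂ with hlb
  set c : Bool → ℕ → Measure EReal := fun b i => (lK ++ lb b).getD i idPLD with hcdef
  have hlbmem : ∀ b, ∀ L ∈ lb b, L ∈ 𝓛 := by
    intro b; cases b
    exacts [hl₂, hl₁]
  have hmem : ∀ b, ∀ L ∈ lK ++ lb b, L ∈ 𝓛 := fun b L hL => by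
    rcases List.mem_append.1 hL with h | h
    exacts [hlK L h, hlbmem b L h]
  have hcmem : ∀ b i, c b i ∈ insert idPLD 𝓛 := fun b i => by
    simp only [hcdef]
    rcases lt_or_ge i (lK ++ lb b).length with h | h
    · rw [List.getD_eq_getElem _ _ h]; exact Or.inr (hmem b _ (List.getElem_mem h))
    · rw [List.getD_eq_default _ _ h]; exact Or.inl rfl
  have hc : ∀ b i, IsLossLaw (c b i) := fun b i => isLossLaw_of_mem_insert h𝓛 (hcmem b i)
  set m := lK.length with hm
  -- The extra round keeps the capacity positive even if all the lists are empty.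
  set j := max l₁.length l₂.length + 1 with hj
  have hlbj : ∀ b, (lb b).length ≤ j := by
    intro b; cases b
    · exact (le_max_right _ _).trans (Nat.le_succ _)
    · exact (le_max_left _ _).trans (Nat.le_succ _)
  have hcm : ∀ b b', ∀ i < m, c b i = c b' i := fun b b' i hi => by
    simp only [hcdef]
    rw [List.getD_append _ _ _ _ hi, List.getD_append _ _ _ _ hi]
  have hcK : ∀ b, compose ((List.range m).map (c b)) = compose lK := fun b => by
    rw [← compose_map_range_getD (fun L hL => h𝓛 L (hlK L hL)) le_rfl]
    congr 1
    refine List.map_congr_left fun i hi => ?_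
    simp only [hcdef]
    rw [List.getD_append _ _ _ _ (List.mem_range.1 hi)]
  have hcL : ∀ b, compose ((List.range j).map fun i => c b (m + i)) = compose (lb b) := fun b => by
    rw [← compose_map_range_getD (fun L hL => h𝓛 L (hlbmem b L hL)) (hlbj b)]
    congr 1
    refine List.map_congr_left fun i _ => ?_
    simp only [hcdef]
    rw [List.getD_append_right _ _ _ _ (by omega), hm, Nat.add_sub_cancel_left]
  have hctot : ∀ b, compose ((List.range (m + j)).map (c b)) =
      (compose lK).conv (compose (lb b)) := fun b => by
    rw [← compose_append (fun L hL => h𝓛 L (hlK L hL)) fun L hL => h𝓛 L (hlbmem b L hL)]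
    refine compose_map_range_getD (fun L hL => h𝓛 L (hmem b L hL)) ?_
    rw [List.length_append]
    have := hlbj b
    omega
  have hlbl : ∀ b, IsLossLaw (compose (lb b)) := fun b =>
    isLossLaw_compose fun L hL => h𝓛 L (hlbmem b L hL)
  have hKL : ∀ b, IsLossLaw ((compose lK).conv (compose (lb b))) := fun b => hKl.conv (hlbl b)
  set g := max (hockeyStick ((compose lK).conv (compose l₁)) γ)
    (hockeyStick ((compose lK).conv (compose l₂)) γ) with hg
  have hgb : ∀ b, hockeyStick ((compose lK).conv (compose (lb b))) γ ≤ g := by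
    intro b; cases b
    exacts [le_max_right _ _, le_max_left _ _]
  -- The least restrictive budget of value `g` at `γ`: it admits both fixed sequences at every
  -- slope, yet leaves no slack at `γ` itself.
  obtain ⟨B, hB, hBγ, hBmax⟩ := exists_isLossLaw_hockeyStick_eq h0 hγ
    (max_le ((hKL true).hockeyStick_le_one γ) ((hKL false).hockeyStick_le_one γ) : g ≤ 1)
    (((hKL true).one_sub_le_hockeyStick γ).trans (hgb true))
  have hadv : (branchMechanism.{u} m hA c hc).IsAdversary (filterRule 𝓛 B) (m + j) :=
    isAdversary_branchMechanism m hA hc hcm hcmem hB fun b x => by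
      rw [hctot]
      exact hBmax _ (hKL b) (hgb b) x
  have hle := hockeyStick_le_of_pldLE (hfree B hB.isPLD (m + j) (by omega) _ hadv) hγ
  have hval := (lintegral_le_hockeyStick_totalPLD m hA hc hcm true j h0 hγ).trans hle
  rw [hBγ, hcK] at hval
  simp only [hcL] at hval
  have hmax : ∀ x, hockeyStick (compose (lb (A x))) (γ * lossRatio x) =
      max (hockeyStick (compose l₁) (γ * lossRatio x))
        (hockeyStick (compose l₂) (γ * lossRatio x)) := by
    intro x
    by_cases hx : hockeyStick (compose l₂) (γ * lossRatio x) ≤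
        hockeyStick (compose l₁) (γ * lossRatio x)
    · have : A x = true := by simp [hAdef, hx]
      rw [this, max_eq_left hx]; rfl
    · have : A x = false := by simpa [hAdef] using hx
      rw [this, max_eq_right (not_le.1 hx).le]; rfl
  simp only [hmax] at hval
  have hcont : ∀ {L : Measure EReal}, IsLossLaw L → ∀ r : ℝ,
      ContinuousAt (fun x => hockeyStick L (γ * lossRatio x)) (r : EReal) := fun hL r => by
    have hfin : γ * lossRatio (r : EReal) ≠ ∞ :=
      ENNReal.mul_ne_top hγ (by simp [lossRatio_eq_top])
    exact ContinuousAt.comp (f := fun x => γ * lossRatio x) (hL.continuousAt_hockeyStick hfin)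
      ((ENNReal.continuous_const_mul hγ).comp continuous_lossRatio).continuousAt
  -- By continuity a strict inequality at a support point holds on a neighbourhood, which has
  -- positive mass.
  have hstrict : ∀ {f f' : EReal → ℝ≥0∞}, Measurable f → Measurable f' → (∀ x, f x ≤ 1) →
      ∀ r : ℝ, (r : EReal) ∈ (compose lK).support → ContinuousAt f r → ContinuousAt f' r →
      f r < f' r → ∫⁻ x, f x ∂(compose lK) < ∫⁻ x, max (f x) (f' x) ∂(compose lK) := by
    intro f f' hf hf' hf1 r hr hc1 hc2 hlt
    have := hKl.prob
    refine lintegral_strict_mono_of_ae_le_of_ae_lt_on (s := {x | f x < f' x})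
      (hf.max hf').aemeasurable ?_ (ae_of_all _ fun x => le_max_left _ _) ?_
      (ae_of_all _ fun x hx => lt_max_of_lt_right hx)
    · exact ((lintegral_mono hf1).trans_lt (by simp)).ne
    · exact ((Measure.mem_support_iff_forall _).1 hr _ (hc1.eventually_lt hc2 hlt)).ne'
  refine absurd hval (not_le.2 (max_lt ?_ ?_))
  · rw [hKl.hockeyStick_conv hLl₁]
    exact hstrict hm₁ hm₂ (fun x => hLl₁.hockeyStick_le_one _) t ht (hcont hLl₁ t) (hcont hLl₂ t) ht'
  · rw [hKl.hockeyStick_conv hLl₂]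
    simp only [max_comm (hockeyStick (compose l₁) _)]
    exact hstrict hm₂ hm₁ (fun x => hLl₂.hockeyStick_le_one _) s hs (hcont hLl₂ s) (hcont hLl₁ s) hs'

end Attack

/-! ### Lattice laws: piecewise affine profiles cannot cross -/

section Lattice

lemma mul_eq_mul_of_sign {u v : ℤ → ℝ} (hu : ∀ n, 0 ≤ u n) (hv : ∀ n, 0 ≤ v n)
    (h : ∀ θ : ℝ, 0 ≤ θ → θ ≤ 1 → ∀ n m, (1 - θ) * u n < θ * v n → (1 - θ) * u m ≤ θ * v m)
    (n m : ℤ) : v n * u m = v m * u n := by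
  have key : ∀ n m, v n * u m ≤ v m * u n := by
    intro n m
    by_contra! hlt
    have h1 : 0 < v n * u m := (mul_nonneg (hv m) (hu n)).trans_lt hlt
    have hpos : 0 < u n + u m + (v n + v m) := by
      have h2 : 0 < u m := pos_of_mul_pos_right h1 (hv n)
      linarith [hu n, hv n, hv m]
    -- The parameter below has odds `(u n + u m) : (v n + v m)`, the mediant of the two ratios,
    -- which separates them when they differ.
    set S := u n + u m + (v n + v m) with hS
    have h1θ : 1 - (u n + u m) / S = (v n + v m) / S := by
      rw [eq_div_iff hpos.ne', sub_mul, div_mul_cancel₀ _ hpos.ne', hS]; ring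
    have := h ((u n + u m) / S) (by have := hu n; have := hu m; positivity)
      (by rw [div_le_one hpos]; linarith [hv n, hv m]) n m (by
        rw [h1θ, div_mul_eq_mul_div, div_mul_eq_mul_div]
        refine (div_lt_div_iff_of_pos_right hpos).2 ?_
        nlinarith)
    rw [h1θ, div_mul_eq_mul_div, div_mul_eq_mul_div, div_le_div_iff_of_pos_right hpos] at this
    nlinarith
  exact le_antisymm (key n m) (key m n)

/-- A function of `x > 0` that is bounded by `1` and by `x`, is affine between consecutive points of
two interlaced geometric progressions of the same ratio, and keeps its sign along every progression
of this ratio, does not change its sign. -/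
lemma false_of_sign_constant {D : ℝ → ℝ} {d s₁ s₂ : ℝ} (hd : 0 < d) {a b : ℤ → ℝ}
    (ha : ∀ n, a n = Real.exp (s₁ + n * d)) (hb : ∀ n, b n = Real.exp (s₂ + n * d))
    (hab : ∀ n (θ : ℝ), 0 ≤ θ → θ ≤ 1 →
      D ((1 - θ) * a n + θ * b n) = (1 - θ) * D (a n) + θ * D (b n))
    (hba : ∀ n (θ : ℝ), 0 ≤ θ → θ ≤ 1 →
      D ((1 - θ) * a (n + 1) + θ * b n) = (1 - θ) * D (a (n + 1)) + θ * D (b n))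
    (hsign : ∀ x, 0 < x → ∀ n : ℤ, 0 < D x → 0 ≤ D (x * Real.exp (n * d)))
    (hD1 : ∀ x, 0 < x → |D x| ≤ 1) (hDx : ∀ x, 0 < x → |D x| ≤ x)
    {i₀ j₀ : ℤ} (hneg : D (a i₀) < 0) (hpos : 0 < D (b j₀)) : False := by
  have ha0 : ∀ n, 0 < a n := fun n => by rw [ha]; exact Real.exp_pos _
  have hb0 : ∀ n, 0 < b n := fun n => by rw [hb]; exact Real.exp_pos _
  have hash : ∀ n m : ℤ, a n * Real.exp ((m - n : ℤ) * d) = a m := fun n m => by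
    rw [ha, ha, ← Real.exp_add]; congr 1; push_cast; ring
  have hbsh : ∀ n m : ℤ, b n * Real.exp ((m - n : ℤ) * d) = b m := fun n m => by
    rw [hb, hb, ← Real.exp_add]; congr 1; push_cast; ring
  have hδ0 : ∀ n, 0 ≤ -D (a n) := by
    intro n
    by_contra! h
    have := hsign (a n) (ha0 n) (i₀ - n) (by linarith)
    rw [hash] at this
    linarith
  have hη0 : ∀ n, 0 ≤ D (b n) := by
    intro n
    have := hsign (b j₀) (hb0 j₀) (n - j₀) hpos
    rwa [hbsh] at this
  have hcomb : ∀ {x y θ : ℝ}, 0 < x → 0 < y → 0 ≤ θ → θ ≤ 1 → 0 < (1 - θ) * x + θ * y := by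
    intro x y θ hx hy h0 h1
    rcases h0.eq_or_lt with rfl | h
    · simpa using hx
    · have := mul_pos h hy
      have := mul_nonneg (sub_nonneg.2 h1) hx.le
      linarith
  -- A shift by the lattice carries the point of parameter `θ` in one cell to that of parameter `θ`
  -- in another. Constancy of sign along shifts thus fixes the ratio of the end values of `D`, the
  -- same in every cell.
  have r1 := mul_eq_mul_of_sign (u := fun n => -D (a n)) (v := fun n => D (b n)) hδ0 hη0 (by
    intro θ h0 h1 n m hlt
    have h2 := hsign _ (hcomb (ha0 n) (hb0 n) h0 h1) (m - n) (by rw [hab n θ h0 h1]; linarith)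
    rw [show ((1 - θ) * a n + θ * b n) * Real.exp ((m - n : ℤ) * d) =
      (1 - θ) * (a n * Real.exp ((m - n : ℤ) * d)) + θ * (b n * Real.exp ((m - n : ℤ) * d)) by ring,
      hash, hbsh, hab m θ h0 h1] at h2
    linarith)
  have r2 := mul_eq_mul_of_sign (u := fun n => -D (a (n + 1))) (v := fun n => D (b n))
    (fun n => hδ0 _) hη0 (by
    intro θ h0 h1 n m hlt
    have h2 := hsign _ (hcomb (ha0 (n + 1)) (hb0 n) h0 h1) (m - n) (by
      rw [hba n θ h0 h1]; linarith)
    have h3 := hash (n + 1) (m + 1)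
    rw [show m + 1 - (n + 1) = m - n by ring] at h3
    rw [show ((1 - θ) * a (n + 1) + θ * b n) * Real.exp ((m - n : ℤ) * d) =
      (1 - θ) * (a (n + 1) * Real.exp ((m - n : ℤ) * d)) + θ * (b n * Real.exp ((m - n : ℤ) * d))
      by ring, h3, hbsh, hba m θ h0 h1] at h2
    linarith)
  set δ : ℤ → ℝ := fun n => -D (a n) with hδ
  have hδi : 0 < δ i₀ := by simp only [hδ]; linarith
  have hηi : 0 < D (b i₀) := by
    have h1 := r1 j₀ i₀
    have h2 : 0 < D (b j₀) * δ i₀ := mul_pos hpos hδi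
    exact pos_of_mul_pos_left (h2.trans_eq h1) (hδ0 _)
  have rec0 : ∀ n, δ (n + 1) * δ i₀ = δ n * δ (i₀ + 1) := by
    intro n
    have e1 : D (b n) * δ i₀ = D (b i₀) * δ n := r1 n i₀
    have e2 : D (b n) * δ (i₀ + 1) = D (b i₀) * δ (n + 1) := r2 n i₀
    refine mul_left_cancel₀ hηi.ne' ?_
    calc D (b i₀) * (δ (n + 1) * δ i₀) = (D (b i₀) * δ (n + 1)) * δ i₀ := by ring
      _ = (D (b n) * δ i₀) * δ (i₀ + 1) := by rw [← e2]; ring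
      _ = _ := by rw [e1]; ring
  -- The two kinds of cells, `[a n, b n]` and `[b n, a (n + 1)]`, combine to make `δ` geometric.
  -- Boundedness upwards gives `r ≤ 1`; downwards `δ` then cannot decay, although `δ n ≤ a n` tends
  -- to `0`.
  set r := δ (i₀ + 1) / δ i₀ with hr
  have hrec : ∀ n, δ (n + 1) = r * δ n := fun n => by
    rw [hr, div_mul_eq_mul_div, eq_div_iff hδi.ne', rec0 n, mul_comm]
  have hr0 : 0 < r := by
    have h1 := hrec (i₀ - 1)
    rw [sub_add_cancel] at h1
    exact pos_of_mul_pos_left (hδi.trans_eq h1) (hδ0 _)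
  have hup : ∀ k : ℕ, δ (i₀ + k) = r ^ k * δ i₀ := by
    intro k
    induction k with
    | zero => simp
    | succ k ih => push_cast; rw [← add_assoc, hrec, ih, pow_succ]; ring
  have hdown : ∀ k : ℕ, δ i₀ = r ^ k * δ (i₀ - k) := by
    intro k
    induction k with
    | zero => simp
    | succ k ih =>
      have h1 := hrec (i₀ - (k + 1 : ℕ))
      rw [show i₀ - ((k + 1 : ℕ) : ℤ) + 1 = i₀ - k by push_cast; ring] at h1
      rw [ih, h1, pow_succ]; ring
  have hr1 : r ≤ 1 := by
    by_contra! h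
    obtain ⟨k, hk⟩ := pow_unbounded_of_one_lt (1 / δ i₀) h
    rw [div_lt_iff₀ hδi, ← hup] at hk
    have := (abs_le.1 (hD1 _ (ha0 (i₀ + k)))).1
    simp only [hδ] at hk
    linarith
  obtain ⟨k, hk⟩ := exists_nat_gt ((s₁ + i₀ * d - Real.log (δ i₀)) / d)
  rw [div_lt_iff₀ hd] at hk
  have h1 : δ i₀ ≤ δ (i₀ - k) := by
    rw [hdown k]
    exact mul_le_of_le_one_left (hδ0 _) (pow_le_one₀ hr0.le hr1)
  have h2 : δ (i₀ - k) ≤ a (i₀ - k) := by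
    have := (abs_le.1 (hDx _ (ha0 (i₀ - k)))).1
    simp only [hδ]; linarith
  have h3 : a (i₀ - k) < δ i₀ := by
    rw [ha, ← Real.exp_log hδi]
    refine Real.exp_lt_exp.2 ?_
    push_cast
    linarith
  linarith

/-- The finite points of the support of `L` lie in a translate of the lattice of mesh `d`. -/
def IsLatticeLaw (L : Measure EReal) (s d : ℝ) : Prop :=
  ∀ x : ℝ, (x : EReal) ∈ L.support → ∃ n : ℤ, x = s + n * d

namespace IsLossLaw

variable {L L' : Measure EReal} {s d : ℝ}

lemma profile_affine (hL : IsLossLaw L) (hd : 0 < d) (hlat : IsLatticeLaw L s d) (n : ℤ)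
    {x y : ℝ} (hx : x ∈ Set.Icc (Real.exp (s + n * d)) (Real.exp (s + (n + 1) * d)))
    (hy : y ∈ Set.Icc (Real.exp (s + n * d)) (Real.exp (s + (n + 1) * d))) {θ : ℝ}
    (h0 : 0 ≤ θ) (h1 : θ ≤ 1) :
    profile L ((1 - θ) * x + θ * y) = (1 - θ) * profile L x + θ * profile L y := by
  have hx0 : 0 ≤ x := (Real.exp_pos _).le.trans hx.1
  have hy0 : 0 ≤ y := (Real.exp_pos _).le.trans hy.1
  have hz : (1 - θ) * x + θ * y ∈ Set.Icc (Real.exp (s + n * d)) (Real.exp (s + (n + 1) * d)) :=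
    convex_Icc _ _ hx hy (by linarith) h0 (by ring)
  have hz0 : 0 ≤ (1 - θ) * x + θ * y := (Real.exp_pos _).le.trans hz.1
  rw [hL.profile_eq_integral hx0, hL.profile_eq_integral hy0, hL.profile_eq_integral hz0,
    ← integral_const_mul, ← integral_const_mul, ← integral_add
      ((hL.integrable_profile hx0).const_mul _) ((hL.integrable_profile hy0).const_mul _)]
  refine integral_congr_ae ?_
  filter_upwards [hL.ae_ne_bot, (Measure.support_mem_ae : L.support ∈ ae L)] with l hl hls
  induction l with
  | bot => exact absurd rfl hl
  | top => simp
  | coe l =>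
    obtain ⟨m, rfl⟩ := hlat l hls
    rw [lossRatio_coe, ENNReal.toReal_ofReal (Real.exp_pos _).le]
    -- The loss `s + m * d` puts its kink at `exp (s + m * d)`, never inside the cell: the integrand
    -- vanishes on the cell or is affine there.
    rcases le_or_gt m n with hmn | hmn
    · have hzero : ∀ z, z ∈ Set.Icc (Real.exp (s + n * d)) (Real.exp (s + (n + 1) * d)) →
          max (1 - z * Real.exp (-(s + m * d))) 0 = 0 := by
        intro z hz
        refine max_eq_right (sub_nonpos.2 ?_)
        calc (1 : ℝ) ≤ Real.exp (s + n * d) * Real.exp (-(s + m * d)) := by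
              rw [← Real.exp_add]
              refine Real.one_le_exp ?_
              have : (m : ℝ) ≤ n := by exact_mod_cast hmn
              nlinarith
          _ ≤ _ := mul_le_mul_of_nonneg_right hz.1 (Real.exp_pos _).le
      rw [hzero _ hx, hzero _ hy, hzero _ hz]; ring
    · have hlin : ∀ z, z ∈ Set.Icc (Real.exp (s + n * d)) (Real.exp (s + (n + 1) * d)) →
          max (1 - z * Real.exp (-(s + m * d))) 0 = 1 - z * Real.exp (-(s + m * d)) := by
        intro z hz
        refine max_eq_left (sub_nonneg.2 ?_)
        calc z * Real.exp (-(s + m * d)) ≤ Real.exp (s + (n + 1) * d) * Real.exp (-(s + m * d)) :=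
              mul_le_mul_of_nonneg_right hz.2 (Real.exp_pos _).le
          _ ≤ 1 := by
              rw [← Real.exp_add]
              refine Real.exp_le_one_iff.2 ?_
              have : (n : ℝ) + 1 ≤ m := by exact_mod_cast hmn
              nlinarith
      rw [hlin _ hx, hlin _ hy, hlin _ hz]; ring

/-- The profile of a lattice law dominates another profile as soon as it does so at its kinks. -/
lemma profile_le_of_le_on_lattice (hL : IsLossLaw L) (hL' : IsLossLaw L') (hd : 0 < d)
    (hlat : IsLatticeLaw L s d)
    (h : ∀ n : ℤ, profile L' (Real.exp (s + n * d)) ≤ profile L (Real.exp (s + n * d)))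
    {x : ℝ} (hx : 0 < x) : profile L' x ≤ profile L x := by
  obtain ⟨n, hn⟩ : ∃ n, n = ⌊(Real.log x - s) / d⌋ := ⟨_, rfl⟩
  have h1 : Real.exp (s + n * d) ≤ x := by
    rw [← Real.le_log_iff_exp_le hx]
    have := Int.floor_le ((Real.log x - s) / d)
    rw [← hn, le_div_iff₀ hd] at this
    linarith
  have h2 : x ≤ Real.exp (s + (n + 1) * d) := by
    rw [← Real.log_le_iff_le_exp hx]
    have := (Int.lt_floor_add_one ((Real.log x - s) / d)).le
    rw [← hn, div_le_iff₀ hd] at this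
    linarith
  have hseg : x ∈ segment ℝ (Real.exp (s + n * d)) (Real.exp (s + (n + 1) * d)) := by
    rw [segment_eq_Icc (h1.trans h2)]; exact ⟨h1, h2⟩
  clear hn
  obtain ⟨α, β, hα, hβ, hαβ, rfl⟩ := hseg
  obtain rfl : α = 1 - β := by linarith
  have h3 := hL'.profile_convexOn.2 (Real.exp_pos (s + n * d)).le
    (Real.exp_pos (s + (n + 1) * d)).le hα hβ hαβ
  have hle : Real.exp (s + n * d) ≤ Real.exp (s + (n + 1) * d) := h1.trans h2
  have h4 := hL.profile_affine hd hlat n (Set.left_mem_Icc.2 hle) (Set.right_mem_Icc.2 hle) hβ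
    (by linarith)
  have h5 := h (n + 1)
  push_cast at h5
  simp only [smul_eq_mul] at h3 ⊢
  rw [h4]
  exact h3.trans (add_le_add (mul_le_mul_of_nonneg_left (h n) hα)
    (mul_le_mul_of_nonneg_left h5 hβ))

lemma abs_profile_sub_le_one (hL : IsLossLaw L) (hL' : IsLossLaw L') (x : ℝ) :
    |profile L x - profile L' x| ≤ 1 := by
  have := hL.profile_nonneg x
  have := hL'.profile_nonneg x
  have := hL.profile_le_one x
  have := hL'.profile_le_one x
  rw [abs_le]; constructor <;> linarith

lemma abs_profile_sub_le (hL : IsLossLaw L) (hL' : IsLossLaw L') {x : ℝ} (hx : 0 < x) :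
    |profile L x - profile L' x| ≤ x := by
  have := hL.one_sub_le_profile hx.le
  have := hL'.one_sub_le_profile hx.le
  have := hL.profile_le_one x
  have := hL'.profile_le_one x
  rw [abs_le]; constructor <;> linarith

end IsLossLaw

lemma IsLatticeLaw.shift {L : Measure EReal} {s d : ℝ} (h : IsLatticeLaw L s d) (k : ℤ) :
    IsLatticeLaw L (s + k * d) d := by
  intro x hx
  obtain ⟨n, rfl⟩ := h x hx
  exact ⟨n - k, by push_cast; ring⟩

/-- Two lattice laws of the same mesh are comparable if the sign of the difference of their profiles
is constant along every translate of the lattice. -/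
lemma profile_comparable_of_lattice {L₁ L₂ : Measure EReal} (h₁ : IsLossLaw L₁)
    (h₂ : IsLossLaw L₂) {d s₁ s₂ : ℝ} (hd : 0 < d) (hl₁ : IsLatticeLaw L₁ s₁ d)
    (hl₂ : IsLatticeLaw L₂ s₂ d)
    (hsign : ∀ x, 0 < x → ∀ n : ℤ, profile L₂ x < profile L₁ x →
      profile L₂ (x * Real.exp (n * d)) ≤ profile L₁ (x * Real.exp (n * d))) :
    (∀ x, 0 < x → profile L₁ x ≤ profile L₂ x) ∨ ∀ x, 0 < x → profile L₂ x ≤ profile L₁ x := by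
  -- Moving the second offset into `[s₁, s₁ + d)` interlaces the two progressions of kinks.
  obtain ⟨k, hk, -⟩ := existsUnique_add_zsmul_mem_Ico hd s₂ s₁
  replace hl₂ := hl₂.shift k
  rw [zsmul_eq_mul] at hk
  set s₂' := s₂ + k * d
  by_contra! hcon
  obtain ⟨⟨p, hp, hp'⟩, q, hq, hq'⟩ := hcon
  -- Between its own kinks a profile is affine and the other one convex. Each profile that fails to
  -- dominate must therefore fail at one of its own kinks, which gives both signs of the difference.
  obtain ⟨i₀, hi₀⟩ : ∃ n : ℤ, profile L₁ (Real.exp (s₁ + n * d)) <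
      profile L₂ (Real.exp (s₁ + n * d)) := by
    by_contra! h
    exact absurd (h₁.profile_le_of_le_on_lattice h₂ hd hl₁ h hq) (not_le.2 hq')
  obtain ⟨j₀, hj₀⟩ : ∃ n : ℤ, profile L₂ (Real.exp (s₂' + n * d)) <
      profile L₁ (Real.exp (s₂' + n * d)) := by
    by_contra! h
    exact absurd (h₂.profile_le_of_le_on_lattice h₁ hd hl₂ h hp) (not_le.2 hp')
  have hexp : ∀ {x y : ℝ}, x ≤ y → Real.exp x ≤ Real.exp y := fun h => Real.exp_le_exp.2 h
  refine false_of_sign_constant (D := fun x => profile L₁ x - profile L₂ x) hd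
    (a := fun n => Real.exp (s₁ + n * d)) (b := fun n => Real.exp (s₂' + n * d))
    (fun _ => rfl) (fun _ => rfl) ?_ ?_ ?_ (fun x _ => h₁.abs_profile_sub_le_one h₂ x)
    (fun x hx => h₁.abs_profile_sub_le h₂ hx) (i₀ := i₀) (j₀ := j₀) (sub_neg.2 hi₀)
    (sub_pos.2 hj₀)
  · intro n θ h0 h1
    have e1 := h₁.profile_affine hd hl₁ n (x := Real.exp (s₁ + n * d))
      (y := Real.exp (s₂' + n * d)) ⟨le_rfl, hexp (by linarith)⟩
      ⟨hexp (by linarith [hk.1]), hexp (by linarith [hk.2])⟩ h0 h1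
    have e2 := h₂.profile_affine hd hl₂ (n - 1) (x := Real.exp (s₁ + n * d))
      (y := Real.exp (s₂' + n * d))
      ⟨hexp (by push_cast; linarith [hk.2]), hexp (by push_cast; linarith [hk.1])⟩
      ⟨hexp (by push_cast; linarith), hexp (by push_cast; linarith)⟩ h0 h1
    rw [e1, e2]; ring
  · intro n θ h0 h1
    have e1 := h₁.profile_affine hd hl₁ n (x := Real.exp (s₁ + (n + 1 : ℤ) * d))
      (y := Real.exp (s₂' + n * d)) ⟨hexp (by push_cast; linarith), hexp (by push_cast; linarith)⟩
      ⟨hexp (by linarith [hk.1]), hexp (by linarith [hk.2])⟩ h0 h1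
    have e2 := h₂.profile_affine hd hl₂ n (x := Real.exp (s₁ + (n + 1 : ℤ) * d))
      (y := Real.exp (s₂' + n * d))
      ⟨hexp (by push_cast; linarith [hk.2]), hexp (by push_cast; linarith [hk.1])⟩
      ⟨le_rfl, hexp (by linarith)⟩ h0 h1
    rw [e1, e2]; ring
  · intro x hx n hpos
    exact sub_nonneg.2 (hsign x hx n (sub_pos.1 hpos))

end Lattice

/-! ### The group of loss differences: dense or cyclic -/

section Differences

variable {𝓛 : Set (Measure EReal)}

/-- Addition on `EReal` is continuous at pairs of finite points, so a neighbourhood of the sum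
contains the image of a product of neighbourhoods. This makes the loss differences closed under
addition. -/
lemma add_mem_support_conv {L L' : Measure EReal} (hL : IsLossLaw L) (hL' : IsLossLaw L') {s t : ℝ}
    (hs : (s : EReal) ∈ L.support) (ht : (t : EReal) ∈ L'.support) :
    ((s + t : ℝ) : EReal) ∈ (L.conv L').support := by
  have := hL.prob
  have := hL'.prob
  rw [Measure.mem_support_iff_forall]
  intro U hU
  have hc : ContinuousAt (fun p : EReal × EReal => p.1 + p.2) ((s : EReal), (t : EReal)) :=
    EReal.continuousAt_add (by simp) (by simp)
  have hU' : (fun p : EReal × EReal => p.1 + p.2) ⁻¹' U ∈ 𝓝 ((s : EReal), (t : EReal)) :=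
    hc (by
      change U ∈ 𝓝 ((s : EReal) + (t : EReal))
      rw [← EReal.coe_add]
      exact hU)
  obtain ⟨V, hV, V', hV', hsub⟩ := mem_nhds_prod_iff.1 hU'
  have hpos : 0 < (L.prod L') (V ×ˢ V') := by
    rw [Measure.prod_prod]
    exact ENNReal.mul_pos ((Measure.mem_support_iff_forall _).1 hs V hV).ne'
      ((Measure.mem_support_iff_forall _).1 ht V' hV').ne'
  exact (hpos.trans_le (measure_mono hsub)).trans_le
    (Measure.le_map_apply measurable_add.aemeasurable U)

/-- The differences of finite values of the privacy loss of non-adaptive compositions. -/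
def lossDifferences (h𝓛 : ∀ L ∈ 𝓛, IsLossLaw L) : AddSubgroup ℝ where
  carrier := {d | ∃ K ∈ compositionClosure 𝓛, ∃ s t : ℝ, (s : EReal) ∈ K.support ∧
    (t : EReal) ∈ K.support ∧ d = s - t}
  zero_mem' := by
    have h0 : ((0 : ℝ) : EReal) ∈ idPLD.support := by
      rw [Measure.mem_support_iff_forall]
      intro U hU
      have : (0 : EReal) ∈ U := by simpa using mem_of_mem_nhds hU
      rw [idPLD, Measure.dirac_apply_of_mem this]
      exact one_pos
    exact ⟨idPLD, ⟨[], by simp, rfl⟩, 0, 0, h0, h0, by simp⟩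
  add_mem' := by
    rintro _ _ ⟨K, hK, s, t, hs, ht, rfl⟩ ⟨K', hK', s', t', hs', ht', rfl⟩
    have h := isLossLaw_of_mem_compositionClosure h𝓛 hK
    have h' := isLossLaw_of_mem_compositionClosure h𝓛 hK'
    exact ⟨K.conv K', conv_mem_compositionClosure h𝓛 hK hK', s + s', t + t',
      add_mem_support_conv h h' hs hs', add_mem_support_conv h h' ht ht', by ring⟩
  neg_mem' := by
    rintro _ ⟨K, hK, s, t, hs, ht, rfl⟩
    exact ⟨K, hK, t, s, ht, hs, by ring⟩

lemma exists_isLatticeLaw (h𝓛 : ∀ L ∈ 𝓛, IsLossLaw L) {d : ℝ}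
    (hd : ∀ x ∈ lossDifferences h𝓛, ∃ n : ℤ, x = n * d) {L : Measure EReal}
    (hL : L ∈ compositionClosure 𝓛) : ∃ s, IsLatticeLaw L s d := by
  by_cases h : ∃ s : ℝ, (s : EReal) ∈ L.support
  · obtain ⟨s, hs⟩ := h
    refine ⟨s, fun x hx => ?_⟩
    obtain ⟨n, hn⟩ := hd (x - s) ⟨L, hL, x, s, hx, hs, rfl⟩
    exact ⟨n, by linarith⟩
  · exact ⟨0, fun x hx => absurd ⟨x, hx⟩ h⟩

/-- If the natural filter is free, the difference of two profiles has the same sign at points whose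
logarithms differ by a difference of losses. -/
lemma profile_le_of_free (h𝓛 : ∀ L ∈ 𝓛, IsLossLaw L)
    (hfree : ∀ B : Measure EReal, IsPLD B → ∀ k : ℕ, 0 < k → FreeNaturalFilter.{u} 𝓛 B k)
    {L₁ L₂ : Measure EReal} (h₁ : L₁ ∈ compositionClosure 𝓛) (h₂ : L₂ ∈ compositionClosure 𝓛)
    {d x : ℝ} (hd : d ∈ lossDifferences h𝓛) (hx : 0 < x) (hlt : profile L₂ x < profile L₁ x) :
    profile L₂ (x * Real.exp d) ≤ profile L₁ (x * Real.exp d) := by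
  obtain ⟨K, hK, t, s, ht, hs, rfl⟩ := hd
  by_contra! hlt'
  have hl₁ := isLossLaw_of_mem_compositionClosure h𝓛 h₁
  have hl₂ := isLossLaw_of_mem_compositionClosure h𝓛 h₂
  have hmul : ∀ r : ℝ, ENNReal.ofReal (x * Real.exp t) * lossRatio r =
      ENNReal.ofReal (x * Real.exp (t - r)) := fun r => by
    rw [lossRatio_coe, ← ENNReal.ofReal_mul (by positivity), mul_assoc, ← Real.exp_add,
      sub_eq_add_neg]
  -- With `γ = x e^t`, the losses `t` and `s` lead to the slopes `x` and `x e^{t - s}`.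
  refine not_crossing_of_free h𝓛 hfree hK h₁ h₂ (γ := ENNReal.ofReal (x * Real.exp t))
    (by simp; positivity) ENNReal.ofReal_ne_top ht hs ?_ ?_
  · rw [hmul, sub_self, Real.exp_zero, mul_one]
    refine lt_of_not_ge fun h => ?_
    exact absurd ((hl₁.hockeyStick_le_iff_profile_le hl₂ x).1 h) (not_le.2 hlt)
  · rw [hmul]
    refine lt_of_not_ge fun h => ?_
    exact absurd ((hl₂.hockeyStick_le_iff_profile_le hl₁ _).1 h) (not_le.2 hlt')

/-- If the natural filter is free, the composition closure of the queries is totally ordered. -/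
theorem total_of_freeNaturalFilter (h𝓛 : ∀ L ∈ 𝓛, IsLossLaw L) (hnd : ∀ L ∈ 𝓛, NonDegenerate L)
    (hfree : ∀ B : Measure EReal, IsPLD B → ∀ k : ℕ, 0 < k → FreeNaturalFilter.{u} 𝓛 B k)
    {L₁ L₂ : Measure EReal} (h₁ : L₁ ∈ compositionClosure 𝓛) (h₂ : L₂ ∈ compositionClosure 𝓛) :
    PLDLE L₁ L₂ ∨ PLDLE L₂ L₁ := by
  have hl₁ := isLossLaw_of_mem_compositionClosure h𝓛 h₁
  have hl₂ := isLossLaw_of_mem_compositionClosure h𝓛 h₂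
  rw [hl₁.pldLE_iff_profile_le hl₂, hl₂.pldLE_iff_profile_le hl₁]
  rcases 𝓛.eq_empty_or_nonempty with rfl | ⟨L, hL⟩
  · have hid : ∀ K ∈ compositionClosure (∅ : Set (Measure EReal)), K = idPLD := by
      rintro _ ⟨l, hl, rfl⟩
      rw [List.eq_nil_iff_forall_not_mem.2 fun K hK => hl K hK, compose_nil]
    rw [hid _ h₁, hid _ h₂]
    exact Or.inl fun _ _ => le_rfl
  rcases (lossDifferences h𝓛).dense_or_cyclic with hdense | ⟨e, he⟩
  · by_contra! hcon
    obtain ⟨⟨p, hp, hp'⟩, q, hq, hq'⟩ := hcon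
    have hopen : IsOpen {d : ℝ | profile L₁ (p * Real.exp d) < profile L₂ (p * Real.exp d)} :=
      isOpen_lt (hl₁.continuous_profile.comp (by fun_prop))
        (hl₂.continuous_profile.comp (by fun_prop))
    obtain ⟨d, hd, hdΔ⟩ := hdense.inter_open_nonempty _ hopen ⟨Real.log (q / p), by
      have : p * Real.exp (Real.log (q / p)) = q := by
        rw [Real.exp_log (div_pos hq hp), mul_div_cancel₀ _ hp.ne']
      simpa [this] using hq'⟩
    exact absurd (profile_le_of_free h𝓛 hfree h₁ h₂ hdΔ hp hp') (not_le.2 hd)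
  · obtain ⟨s, t, hst, hs, ht⟩ := hnd L hL
    have hLc : L ∈ compositionClosure 𝓛 :=
      ⟨[L], by simpa using hL, compose_singleton (h𝓛 L hL)⟩
    have hmem : ∀ x, x ∈ lossDifferences h𝓛 ↔ ∃ n : ℤ, x = n * e := fun x => by
      rw [he, AddSubgroup.mem_closure_singleton]
      simp only [zsmul_eq_mul, eq_comm]
    -- Non-degeneracy enters only here: two distinct finite losses of one query make the group
    -- nontrivial.
    have he0 : e ≠ 0 := by
      rintro rfl
      obtain ⟨n, hn⟩ := (hmem (s - t)).1 ⟨L, hLc, s, t, hs, ht, rfl⟩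
      exact hst (by simpa [sub_eq_zero] using hn)
    have hmem' : ∀ x, x ∈ lossDifferences h𝓛 ↔ ∃ n : ℤ, x = n * |e| := fun x => by
      rw [hmem]
      rcases abs_choice e with h | h
      · rw [h]
      · rw [h]
        constructor
        · rintro ⟨n, rfl⟩; exact ⟨-n, by push_cast; ring⟩
        · rintro ⟨n, rfl⟩; exact ⟨-n, by push_cast; ring⟩
    obtain ⟨s₁, hs₁⟩ := exists_isLatticeLaw h𝓛 (fun x hx => (hmem' x).1 hx) h₁
    obtain ⟨s₂, hs₂⟩ := exists_isLatticeLaw h𝓛 (fun x hx => (hmem' x).1 hx) h₂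
    exact profile_comparable_of_lattice hl₁ hl₂ (abs_pos.2 he0) hs₁ hs₂ fun x hx n hlt =>
      profile_le_of_free h𝓛 hfree h₁ h₂ ((hmem' _).2 ⟨n, rfl⟩) hx hlt

end Differences

end PrivacyFilter

theorem mainTheorem1 (𝓛 : Set (Measure EReal))
    (hPLD : ∀ L ∈ 𝓛, PrivacyFilter.IsPLD L)
    (hnd : ∀ L ∈ 𝓛, PrivacyFilter.NonDegenerate L) :
    (∀ B : Measure EReal, PrivacyFilter.IsPLD B → ∀ k : ℕ, 0 < k →
        PrivacyFilter.FreeNaturalFilter.{u} 𝓛 B k) ↔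
      (∀ L₁ ∈ PrivacyFilter.compositionClosure 𝓛, ∀ L₂ ∈ PrivacyFilter.compositionClosure 𝓛,
        PrivacyFilter.PLDLE L₁ L₂ ∨ PrivacyFilter.PLDLE L₂ L₁) := by
  have h𝓛 : ∀ L ∈ 𝓛, PrivacyFilter.IsLossLaw L := fun L hL =>
    PrivacyFilter.isPLD_iff.1 (hPLD L hL)
  constructor
  · intro hfree L₁ h₁ L₂ h₂
    exact PrivacyFilter.total_of_freeNaturalFilter h𝓛 hnd hfree h₁ h₂
  · intro hord B hB k hk
    exact PrivacyFilter.freeNaturalFilter_of_total h𝓛 hord (PrivacyFilter.isPLD_iff.1 hB) hk
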